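/- Let $k$ be a field, $K\supseteq k$ a field extension, $n\ge 0$, and let $X$ be a finite non-empty set of generic points of $\mathbf P^n(K)$: that is, the points of $X$ have homogeneous coordinate vectors $(\xi_{p,0},\dots,\xi_{p,n})$, $p\in X$, such that all the coordinates $\xi_{p,j}$ ($p\in X$, $0\le j\le n$) together are algebraically independent over $k$. Let $R(X)=K[x_0,\dots,x_n]/I(X)$ be the homogeneous coordinate ring of $X$, where $I(X)$ is the ideal generated by the homogeneous polynomials vanishing at all points of $X$, with its standard grading. Then $R(X)$ is Koszul (that is, for all $i\ge 0$ all generators of the $i$-th free module in the minimal graded free $R(X)$-resolution of the residue field $K=R(X)/\bigoplus_{i>0}R(X)_i$ have degree $i$) if and only if $$|X|\le 1+n+\frac{n^2}{4}.$$ -/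

import Mathlib

/-- The irrelevant ideal `⨁_{i > 0} R_i` of a graded ring `R = ⨁ R_i`
(as an ideal, it is generated by the homogeneous elements of positive degree). -/
def irrelevantIdeal {K R : Type*} [Field K] [CommRing R] [Algebra K R]
    (𝒜 : ℕ → Submodule K R) : Ideal R :=
  Ideal.span {x | ∃ i, 0 < i ∧ x ∈ 𝒜 i}

/-- The degree `m` component of the graded free module `⨁_a R(-deg a)`: the `a`-th basis
vector sits in degree `deg a`, so the `a`-th coordinate of an element of degree `m` lies in
`R_{m - deg a}`, which is zero if `m < deg a`. -/
def shiftedPiece {K R : Type*} [Field K] [CommRing R] [Algebra K R]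
    (𝒜 : ℕ → Submodule K R) {b : ℕ} (deg : Fin b → ℕ) (m : ℕ) : Set (Fin b → R) :=
  {v | ∀ a, (deg a ≤ m → v a ∈ 𝒜 (m - deg a)) ∧ (m < deg a → v a = 0)}

/-- A minimal graded free resolution
`⋯ → F 2 → F 1 → F 0 → R / (⨁_{i > 0} R_i) → 0` of the residue field of a graded ring `R`, with
`F i = ⨁_a R(-deg i a)` of finite rank `betti i`. -/
structure MinimalResolution {K R : Type*} [Field K] [CommRing R] [Algebra K R]
    (𝒜 : ℕ → Submodule K R) where
  /-- the rank of the `i`-th free module -/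
  betti : ℕ → ℕ
  /-- the degrees of the generators of the `i`-th free module -/
  deg : ∀ i, Fin (betti i) → ℕ
  /-- the differentials -/
  d : ∀ i, (Fin (betti (i + 1)) → R) →ₗ[R] (Fin (betti i) → R)
  /-- the augmentation onto the residue field -/
  aug : (Fin (betti 0) → R) →ₗ[R] R ⧸ irrelevantIdeal 𝒜
  /-- the differentials preserve degrees -/
  d_homogeneous : ∀ i m, ∀ v ∈ shiftedPiece 𝒜 (deg (i + 1)) m,
    d i v ∈ shiftedPiece 𝒜 (deg i) m
  /-- the augmentation preserves degrees (the residue field is concentrated in degree zero) -/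
  aug_homogeneous : ∀ m, m ≠ 0 → ∀ v ∈ shiftedPiece 𝒜 (deg 0) m, aug v = 0
  /-- exactness at `F (i + 1)` -/
  exact : ∀ i, Function.Exact (d (i + 1)) (d i)
  /-- exactness at `F 0` -/
  exact_aug : Function.Exact (d 0) aug
  /-- exactness at the residue field -/
  aug_surjective : Function.Surjective aug
  /-- minimality: the matrices of the differentials have entries in the irrelevant ideal -/
  minimal : ∀ i v a, d i v a ∈ irrelevantIdeal 𝒜

/-- A standard graded algebra is Koszul if, for all `i`, the generators of the `i`-th free module
in the (essentially unique) minimal graded free resolution of its residue field have degree `i`. -/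
def IsKoszul {K R : Type*} [Field K] [CommRing R] [Algebra K R]
    (𝒜 : ℕ → Submodule K R) : Prop :=
  ∃ F : MinimalResolution 𝒜, ∀ i a, F.deg i a = i

/-- The homogeneous vanishing ideal of a set of points of `ℙⁿ(K)`: it is generated by the
homogeneous polynomials vanishing at all points of the set. -/
noncomputable def projVanishingIdeal {K : Type*} [Field K] {n : ℕ}
    (X : Set (Projectivization K (Fin (n + 1) → K))) : Ideal (MvPolynomial (Fin (n + 1)) K) :=
  Ideal.span {f | (∃ d, f.IsHomogeneous d) ∧ ∀ p ∈ X, MvPolynomial.eval p.rep f = 0}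

/-- The homogeneous coordinate ring `R(X) = K[x_0, …, x_n] / I(X)`. -/
abbrev CoordRing {K : Type*} [Field K] {n : ℕ}
    (X : Set (Projectivization K (Fin (n + 1) → K))) : Type _ :=
  MvPolynomial (Fin (n + 1)) K ⧸ projVanishingIdeal X

/-- The standard grading of `R(X)`: the degree `d` component is the image of the forms of
degree `d`. -/
noncomputable def CoordRing.grading {K : Type*} [Field K] {n : ℕ}
    (X : Set (Projectivization K (Fin (n + 1) → K))) (d : ℕ) : Submodule K (CoordRing X) :=
  (MvPolynomial.homogeneousSubmodule (Fin (n + 1)) K d).map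
    (Ideal.Quotient.mkₐ K (projVanishingIdeal X)).toLinearMap

/-- `X` is a set of generic points of `ℙⁿ(K)` over the subfield `k`: the points of `X` have
homogeneous coordinate vectors whose entries, all together, are algebraically independent
over `k`, that is, are independent indeterminates over `k`. -/
def IsGenericPoints (k : Type*) {K : Type*} [Field k] [Field K] [Algebra k K] {n : ℕ}
    (X : Set (Projectivization K (Fin (n + 1) → K))) : Prop :=
  ∃ v : X → Fin (n + 1) → K,
    (∀ p : X, ∃ h : v p ≠ 0, Projectivization.mk K (v p) h = p) ∧
    AlgebraicIndependent k (fun q : X × Fin (n + 1) => v q.1 q.2)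

/-! ### Linear resolutions given by matrices -/

open Matrix

universe u v w

/-! Write R = R(X) and s = |X|. By genericity no coordinate of a point vanishes, so x_0 is a
nonzerodivisor on R.

Sufficiency. Write s = 1 + r + m, where r = n, or r = s - 1 and m = 0. Then R/(x_0) = K ⊕ V ⊕ U with
dim V = r, dim U = m, and everything depends on the product μ : V × V → U. Put W_0 = 0, W_1 = K,
W_{j+2} = ker(V ⊗ W_{j+1} → U ⊗ W_j). If all these maps are onto (`LinearStrand`), the W_{j+1}
generate a linear resolution of K over R/(x_0), and a mapping cone over x_0 turns it into one over R
(`coneMatrix_exact`, `LinearStrand.isKoszul`). The bound gives 4m ≤ r², so some complete bipartite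
graph on r vertices has at least m edges. Specialise the points to the origin, the unit vectors e_i
and the sums e_a + e_b over m edges ab. There the edge products x_a x_b form a basis of U, and
products within one side q of the graph vanish. A local ring O maps both to k, giving the special
points, and to K, giving X. Over O the products within q lie in the maximal ideal, which suffices to
prove surjectivity for all j by induction (`exists_next_matrix`).

Necessity. If s is at most the number of quadratic monomials, the Hilbert function starts 1, n + 1,
s, s. Counting dimensions in a linear resolution gives b_{j+2} = n b_{j+1} - (s - n - 1) b_j for j ≥
2 (`betti_recurrence`). Above the bound its discriminant is negative, and no positive solution
exists (`not_linear_recurrence`). Otherwise no quadric contains X; a linear resolution then forces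
I(X) = 0 (`eq_zero_of_mk_eq_zero`), although a product of linear forms vanishes on X. Both cases
rest on `AlgebraicIndependent.det_monomial_ne_zero`. -/

theorem isKoszul_of_linear_resolution {K R : Type*} [Field K] [CommRing R] [Algebra K R]
    (𝒜 : ℕ → Submodule K R)
    (hmul : ∀ i j x y, x ∈ 𝒜 i → y ∈ 𝒜 j → x * y ∈ 𝒜 (i + j))
    (ι : ℕ → Type) [∀ i, Fintype (ι i)] (hι : Fintype.card (ι 0) = 1)
    (M : ∀ i, Matrix (ι i) (ι (i + 1)) R) (hM : ∀ i a b, M i a b ∈ 𝒜 1)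
    (hexact : ∀ i, Function.Exact (M (i + 1)).mulVecLin (M i).mulVecLin)
    (haug : ∀ v : ι 0 → R, (∀ a, v a ∈ irrelevantIdeal 𝒜) ↔ ∃ w, M 0 *ᵥ w = v) :
    IsKoszul 𝒜 := by
  classical
  let e : ∀ i, ι i ≃ Fin (Fintype.card (ι i)) := fun i => Fintype.equivFin (ι i)
  let E : ∀ i, (ι i → R) ≃ₗ[R] (Fin (Fintype.card (ι i)) → R) := fun i =>
    LinearEquiv.funCongrLeft R R (e i).symm
  have hE : ∀ i v a, E i v a = v ((e i).symm a) := fun i v a => rfl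
  have hE' : ∀ i v a, (E i).symm v a = v (e i a) := fun i v a => rfl
  have hmem : ∀ i a b, M i a b ∈ irrelevantIdeal 𝒜 := fun i a b =>
    Ideal.subset_span ⟨1, one_pos, hM i a b⟩
  let a0 : Fin (Fintype.card (ι 0)) := ⟨0, by omega⟩
  have ha0 : ∀ a, a = a0 := fun a => Fin.ext (by have := a.2; simp only [a0]; omega)
  refine ⟨⟨fun i => Fintype.card (ι i), fun i _ => i,
    fun i => (E i).toLinearMap ∘ₗ (M i).mulVecLin ∘ₗ (E (i + 1)).symm.toLinearMap,
    (irrelevantIdeal 𝒜).mkQ ∘ₗ LinearMap.proj a0, ?_, ?_, ?_, ?_, ?_, ?_⟩, fun _ _ => rfl⟩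
  · intro i m v hv a
    simp only [LinearMap.comp_apply, LinearEquiv.coe_coe, hE, Matrix.mulVecLin_apply,
      Matrix.mulVec, dotProduct, hE']
    constructor
    · intro him
      refine Submodule.sum_mem _ fun b _ => ?_
      by_cases h : i + 1 ≤ m
      · have := hmul 1 (m - (i + 1)) _ _ (hM i ((e i).symm a) b) ((hv (e (i + 1) b)).1 h)
        rwa [show 1 + (m - (i + 1)) = m - i by omega] at this
      · rw [(hv (e (i + 1) b)).2 (show m < i + 1 by omega)]
        simp
    · intro him
      refine Finset.sum_eq_zero fun b _ => ?_
      rw [(hv (e (i + 1) b)).2 (show m < i + 1 by omega)]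
      simp
  · intro m hm v hv
    simp only [LinearMap.comp_apply, LinearMap.proj_apply, Submodule.mkQ_apply,
      Submodule.Quotient.mk_eq_zero]
    refine Ideal.subset_span ⟨m, Nat.pos_of_ne_zero hm, ?_⟩
    simpa using (hv a0).1 (Nat.zero_le _)
  · intro i v
    have := hexact i ((E (i + 1)).symm v)
    simp only [LinearMap.comp_apply, LinearEquiv.coe_coe, LinearEquiv.map_eq_zero_iff, this]
    constructor
    · rintro ⟨w, hw⟩
      exact ⟨E (i + 2) w, by simp [hw]⟩
    · rintro ⟨w, rfl⟩
      exact ⟨(E (i + 2)).symm w, by simp⟩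
  · intro v
    have := haug ((E 0).symm v)
    simp only [LinearMap.comp_apply, LinearMap.proj_apply, Submodule.mkQ_apply,
      Submodule.Quotient.mk_eq_zero]
    have h1 : v a0 ∈ irrelevantIdeal 𝒜 ↔ ∀ a, (E 0).symm v a ∈ irrelevantIdeal 𝒜 :=
      ⟨fun h a => by rw [hE', ha0 (e 0 a)]; exact h, fun h => by
        have := h ((e 0).symm a0)
        simpa [hE'] using this⟩
    rw [h1, this]
    constructor
    · rintro ⟨w, hw⟩
      exact ⟨E 1 w, by simp [hw]⟩
    · rintro ⟨w, rfl⟩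
      exact ⟨(E 1).symm w, by simp⟩
  · intro y
    obtain ⟨x, rfl⟩ := Submodule.mkQ_surjective _ y
    exact ⟨fun _ => x, rfl⟩
  · intro i v a
    simp only [LinearMap.comp_apply, LinearEquiv.coe_coe, hE, Matrix.mulVecLin_apply,
      Matrix.mulVec, dotProduct]
    exact Ideal.sum_mem _ fun b _ => Ideal.mul_mem_right _ _ (hmem _ _ _)

/-! ### Mapping cone over a nonzerodivisor -/

/-- The mapping cone of a sequence of matrices that is a complex modulo `l`. -/
def coneMatrix {R : Type*} [CommRing R] (l : R) {a b c : Type*} [DecidableEq b]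
    (D' : Matrix b c R) (D : Matrix a b R) (H : Matrix a c R) : Matrix (b ⊕ a) (c ⊕ b) R :=
  Matrix.fromBlocks D' (l • (1 : Matrix b b R)) H (-D)

/-- Cancelling l shows that the homotopies `H` commute with `D`, so the cones form a complex. A
cycle (x, y) satisfies D x ≡ 0 mod l, so `hD` writes x = D x' + l x''; then (x', x'') maps to a
cycle with first component x, and cancelling l makes its second component y. -/
theorem coneMatrix_exact {R : Type*} [CommRing R] {l : R} (hl : ∀ x, l * x = 0 → x = 0)
    (w : ℕ → ℕ) (D : ∀ j, Matrix (Fin (w j)) (Fin (w (j + 1))) R)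
    (H : ∀ j, Matrix (Fin (w j)) (Fin (w (j + 2))) R)
    (hDH : ∀ j, D j * D (j + 1) = -(l • H j))
    (hD : ∀ j v z, D (j + 1) *ᵥ v = l • z → ∃ v' z', v = D (j + 2) *ᵥ v' + l • z') (i : ℕ) :
    Function.Exact (coneMatrix l (D (i + 2)) (D (i + 1)) (H (i + 1))).mulVecLin
      (coneMatrix l (D (i + 1)) (D i) (H i)).mulVecLin := by
  have hcomm : H i * D (i + 2) = D i * H (i + 1) := by
    have h : l • (H i * D (i + 2) - D i * H (i + 1)) = 0 := by
      have h1 : l • H i = -(D i * D (i + 1)) := by rw [hDH, neg_neg]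
      have h2 : l • H (i + 1) = -(D (i + 1) * D (i + 2)) := by rw [hDH, neg_neg]
      rw [smul_sub, ← Matrix.smul_mul, ← Matrix.mul_smul, h1, h2]
      simp [Matrix.mul_assoc]
    ext a b
    have := congrFun (congrFun h a) b
    exact sub_eq_zero.1 (hl _ (by simpa using this))
  have hzero : coneMatrix l (D (i + 1)) (D i) (H i) *
      coneMatrix l (D (i + 2)) (D (i + 1)) (H (i + 1)) = 0 := by
    simp only [coneMatrix, Matrix.fromBlocks_multiply, hDH, hcomm, ← Matrix.fromBlocks_zero]
    congr 1 <;> simp [hDH]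
  intro v
  simp only [Matrix.mulVecLin_apply]
  constructor
  · intro hv
    obtain ⟨x, y, rfl⟩ : ∃ x y, v = Sum.elim x y := ⟨v ∘ Sum.inl, v ∘ Sum.inr, by simp⟩
    have hx : D (i + 1) *ᵥ x + l • y = 0 := by
      ext a
      have := congrFun hv (Sum.inl a)
      simpa [coneMatrix, Matrix.fromBlocks_mulVec, Matrix.smul_mulVec] using this
    obtain ⟨x', x'', hx'⟩ := hD i x (-y) (by rw [smul_neg, eq_neg_iff_add_eq_zero, hx])
    refine ⟨Sum.elim x' x'', ?_⟩
    set u := coneMatrix l (D (i + 2)) (D (i + 1)) (H (i + 1)) *ᵥ Sum.elim x' x'' with hu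
    have hux : u ∘ Sum.inl = x := by
      ext a
      simp [hu, coneMatrix, Matrix.fromBlocks_mulVec, Matrix.smul_mulVec, hx']
    have hud : coneMatrix l (D (i + 1)) (D i) (H i) *ᵥ u = 0 := by
      rw [hu, Matrix.mulVec_mulVec, hzero, Matrix.zero_mulVec]
    ext (a | a)
    · change u (Sum.inl a) = _
      simp [← hux]
    · have h1 := congrFun hud (Sum.inl a)
      have h2 : u = Sum.elim x (u ∘ Sum.inr) := by
        rw [← hux, Sum.elim_comp_inl_inr]
      rw [h2] at h1
      have h3 := congrFun hx a
      have h4 : l * (u (Sum.inr a) - y a) = 0 := by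
        simp [coneMatrix, Matrix.fromBlocks_mulVec, Matrix.smul_mulVec] at h1 h3
        linear_combination h1 - h3
      simpa using sub_eq_zero.1 (hl _ h4)
  · rintro ⟨u, rfl⟩
    rw [Matrix.mulVecLin_apply, Matrix.mulVec_mulVec, hzero, Matrix.zero_mulVec]

/-! ### Linear strands over a local ring -/

/-- A surjection of finite free modules over a local ring splits with free kernel. -/
theorem exists_kernel_matrix {O : Type*} [CommRing O] [IsLocalRing O] {I J : Type*} [Fintype I]
    [Fintype J] [DecidableEq I] [DecidableEq J] (F : Matrix I J O) (S : Matrix J I O)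
    (hFS : F * S = 1) :
    ∃ (w : ℕ) (N : Matrix J (Fin w) O) (T : Matrix (Fin w) J O),
      T * N = 1 ∧ N * T + S * F = 1 ∧ F * N = 0 := by
  let p := LinearMap.ker F.mulVecLin
  have hF : F * (1 - S * F) = 0 := by
    rw [Matrix.mul_sub, Matrix.mul_one, ← Matrix.mul_assoc, hFS, Matrix.one_mul, sub_self]
  let π : (J → O) →ₗ[O] p := LinearMap.codRestrict p (1 - S * F).mulVecLin fun v => by
    change F *ᵥ ((1 - S * F) *ᵥ v) = 0
    rw [Matrix.mulVec_mulVec, hF, Matrix.zero_mulVec]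
  have hπ : ∀ x : p, π x = x := by
    rintro ⟨x, hx⟩
    ext1
    change (1 - S * F) *ᵥ x = x
    change F *ᵥ x = 0 at hx
    rw [Matrix.sub_mulVec, ← Matrix.mulVec_mulVec, hx]
    simp
  have hπs : Function.Surjective π := fun x => ⟨x, hπ x⟩
  have : Module.Finite O p := Module.Finite.of_surjective π hπs
  have : Module.Projective O p :=
    Module.Projective.of_split p.subtype π (LinearMap.ext hπ)
  have : Module.Free O p := Module.free_of_flat_of_isLocalRing
  let b := Module.finBasis O p
  let f : (Fin (Module.finrank O p) → O) →ₗ[O] (J → O) :=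
    p.subtype ∘ₗ b.equivFun.symm.toLinearMap
  let g : (J → O) →ₗ[O] (Fin (Module.finrank O p) → O) := b.equivFun.toLinearMap ∘ₗ π
  have hgf : g ∘ₗ f = LinearMap.id := by
    refine LinearMap.ext fun x => ?_
    change b.equivFun (π (b.equivFun.symm x : p)) = x
    rw [hπ, LinearEquiv.apply_symm_apply]
  have hfg : f ∘ₗ g = (1 - S * F).mulVecLin := by
    refine LinearMap.ext fun x => ?_
    change ((b.equivFun.symm (b.equivFun (π x)) : p) : J → O) = _
    rw [LinearEquiv.symm_apply_apply]
    rfl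
  refine ⟨_, LinearMap.toMatrix' f, LinearMap.toMatrix' g, ?_, ?_, ?_⟩
  · rw [← LinearMap.toMatrix'_comp, hgf, LinearMap.toMatrix'_id]
  · rw [← LinearMap.toMatrix'_comp, hfg, ← Matrix.toLin'_apply', LinearMap.toMatrix'_toLin']
    simp
  · have h : F.mulVecLin ∘ₗ f = 0 := by
      refine LinearMap.ext fun x => ?_
      exact (b.equivFun.symm x : p).2
    have := congrArg LinearMap.toMatrix' h
    rwa [LinearMap.toMatrix'_comp, ← Matrix.toLin'_apply', LinearMap.toMatrix'_toLin', map_zero]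
      at this

/-- The matrix of `V ⊗ W' → U ⊗ W`, `v ⊗ w' ↦ μ(v, N w')`, for a bilinear map `μ : V × V → U` with
coordinates `μ` and a map `N : W' → V ⊗ W`. -/
def quadMatrix {O : Type*} [CommRing O] {r m w w' : ℕ} (μ : Fin r → Fin r → Fin m → O)
    (N : Matrix (Fin r × Fin w) (Fin w') O) : Matrix (Fin m × Fin w) (Fin r × Fin w') O :=
  fun y z => ∑ b, μ z.1 b y.1 * N (b, y.2) z.2

theorem quadMatrix_map {O K : Type*} [CommRing O] [CommRing K] (f : O →+* K) {r m w w' : ℕ}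
    (μ : Fin r → Fin r → Fin m → O) (N : Matrix (Fin r × Fin w) (Fin w') O) :
    (quadMatrix μ N).map f = quadMatrix (fun a b k => f (μ a b k)) (N.map f) := by
  ext y z
  simp [quadMatrix]

theorem quadMatrix_mul {O : Type*} [CommRing O] {r m w w' : ℕ} {J : Type*}
    (μ : Fin r → Fin r → Fin m → O) (N : Matrix (Fin r × Fin w) (Fin w') O) (T : Matrix (Fin w') J O)
    (y : Fin m × Fin w) (a : Fin r) (z : J) :
    ∑ c, quadMatrix μ N y (a, c) * T c z = ∑ b, μ a b y.1 * (N * T) (b, y.2) z := by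
  simp only [quadMatrix, Finset.sum_mul, Matrix.mul_apply, Finset.mul_sum]
  rw [Finset.sum_comm]
  simp [mul_assoc]

/-- The invariant that propagates is a section `S` supported on the rows in `q`. Composing the next
quadratic map with a candidate section gives the identity minus a sum of terms μ(B, b) · (S ·
quad)(b, ·). For b in `q` the first factor lies in the maximal ideal; for other b the second is
zero. The composite is therefore the identity modulo the maximal ideal, hence invertible. -/
theorem exists_next_matrix {O : Type*} [CommRing O] [IsLocalRing O] {r m w w' : ℕ}
    (μ : Fin r → Fin r → Fin m → O) (q : Fin r → Prop) (A B : Fin m → Fin r)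
    (hB : ∀ t, q (B t)) (hBA : ∀ t k, μ (B t) (A t) k = if k = t then 1 else 0)
    (hq : ∀ i j k, q i → q j → μ i j k ∈ IsLocalRing.maximalIdeal O)
    (N : Matrix (Fin r × Fin w) (Fin w') O) (S : Matrix (Fin r × Fin w') (Fin m × Fin w) O)
    (hS : quadMatrix μ N * S = 1) (hSq : ∀ a c y, ¬ q a → S (a, c) y = 0) :
    ∃ (w'' : ℕ) (N' : Matrix (Fin r × Fin w') (Fin w'') O)
      (T : Matrix (Fin w'') (Fin r × Fin w') O)
      (S' : Matrix (Fin r × Fin w'') (Fin m × Fin w') O),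
      T * N' = 1 ∧ N' * T + S * quadMatrix μ N = 1 ∧ quadMatrix μ N * N' = 0 ∧
      quadMatrix μ N' * S' = 1 ∧ ∀ a c y, ¬ q a → S' (a, c) y = 0 := by
  classical
  obtain ⟨w'', N', T, h1, h2, h3⟩ := exists_kernel_matrix (quadMatrix μ N) S hS
  -- The candidate sends u_t ⊗ z to x_{B t} ⊗ T(x_{A t} ⊗ z), because x_{B t} x_{A t} = u_t.
  let S0 : Matrix (Fin r × Fin w'') (Fin m × Fin w') O := fun x y =>
    if x.1 = B y.1 then T x.2 (A y.1, y.2) else 0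
  have hprod : ∀ x y, (quadMatrix μ N' * S0) x y = (1 : Matrix (Fin m × Fin w') _ O) x y -
      ∑ b, μ (B y.1) b x.1 * (S * quadMatrix μ N) (b, x.2) (A y.1, y.2) := by
    intro x y
    have e1 : (quadMatrix μ N' * S0) x y =
        ∑ c, quadMatrix μ N' x (B y.1, c) * T c (A y.1, y.2) := by
      rw [Matrix.mul_apply, Fintype.sum_prod_type, Finset.sum_eq_single (B y.1)]
      · simp [S0]
      · intro a _ ha
        simp [S0, ha]
      · simp
    rw [e1, quadMatrix_mul, eq_sub_of_add_eq h2]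
    simp only [Matrix.sub_apply, mul_sub, Finset.sum_sub_distrib]
    have e2 : ∑ b, μ (B y.1) b x.1 * (1 : Matrix (Fin r × Fin w') _ O) (b, x.2) (A y.1, y.2)
        = (1 : Matrix (Fin m × Fin w') _ O) x y := by
      rw [Finset.sum_eq_single (A y.1)]
      · rw [hBA]
        obtain ⟨x1, x2⟩ := x
        obtain ⟨y1, y2⟩ := y
        by_cases e : x1 = y1 <;> simp [Matrix.one_apply, e]
      · intro b _ hb
        simp [hb]
      · simp
    rw [← e2]
  have hunit : IsUnit (quadMatrix μ N' * S0) := by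
    rw [Matrix.isUnit_iff_isUnit_det]
    have : IsUnit (IsLocalRing.residue O (quadMatrix μ N' * S0).det) := by
      rw [RingHom.map_det]
      have : (IsLocalRing.residue O).mapMatrix (quadMatrix μ N' * S0) = 1 := by
        ext x y
        rw [RingHom.mapMatrix_apply, Matrix.map_apply, hprod, map_sub]
        have : IsLocalRing.residue O (∑ b, μ (B y.1) b x.1 *
            (S * quadMatrix μ N) (b, x.2) (A y.1, y.2)) = 0 := by
          rw [IsLocalRing.residue_eq_zero_iff]
          refine Ideal.sum_mem _ fun b _ => ?_
          by_cases hb : q b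
          · exact Ideal.mul_mem_right _ _ (hq _ _ _ (hB _) hb)
          · have : (S * quadMatrix μ N) (b, x.2) (A y.1, y.2) = 0 := by
              rw [Matrix.mul_apply]
              exact Finset.sum_eq_zero fun z _ => by rw [hSq _ _ _ hb, zero_mul]
            rw [this, mul_zero]
            exact zero_mem _
        rw [this, sub_zero]
        by_cases e : x = y <;> simp [Matrix.one_apply, e]
      rw [this, Matrix.det_one]
      exact isUnit_one
    exact (isUnit_map_iff _ _).1 this
  obtain ⟨Y, hY⟩ := hunit.exists_right_inv
  refine ⟨w'', N', T, S0 * Y, h1, h2, h3, by rw [← Matrix.mul_assoc, hY], ?_⟩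
  intro a c y ha
  rw [Matrix.mul_apply]
  refine Finset.sum_eq_zero fun z _ => ?_
  have : a ≠ B z.1 := fun h => ha (h ▸ hB _)
  simp [S0, this]

/-- The coordinates of the linear strand attached to a bilinear map with coordinates `μ`:
split exact sequences `0 → W (j + 2) → V ⊗ W (j + 1) → U ⊗ W j → 0`. -/
structure LinearStrand {O : Type*} [CommRing O] {r m : ℕ} (μ : Fin r → Fin r → Fin m → O) where
  w : ℕ → ℕ
  w_zero : w 0 = 0
  w_one : w 1 = 1
  N : ∀ j, Matrix (Fin r × Fin (w j)) (Fin (w (j + 1))) O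
  S : ∀ j, Matrix (Fin r × Fin (w (j + 1))) (Fin m × Fin (w j)) O
  T : ∀ j, Matrix (Fin (w (j + 2))) (Fin r × Fin (w (j + 1))) O
  quad_mul_S : ∀ j, quadMatrix μ (N j) * S j = 1
  T_mul_N : ∀ j, T j * N (j + 1) = 1
  N_mul_T : ∀ j, N (j + 1) * T j + S j * quadMatrix μ (N j) = 1
  quad_mul_N : ∀ j, quadMatrix μ (N j) * N (j + 1) = 0

/-- Extension of scalars of a linear strand. -/
def LinearStrand.map {O K : Type*} [CommRing O] [CommRing K] (f : O →+* K) {r m : ℕ}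
    {μ : Fin r → Fin r → Fin m → O} (L : LinearStrand μ) :
    LinearStrand fun a b k => f (μ a b k) where
  w := L.w
  w_zero := L.w_zero
  w_one := L.w_one
  N j := (L.N j).map f
  S j := (L.S j).map f
  T j := (L.T j).map f
  quad_mul_S j := by
    rw [← quadMatrix_map, ← Matrix.map_mul, L.quad_mul_S, Matrix.map_one _ f.map_zero f.map_one]
  T_mul_N j := by
    rw [← Matrix.map_mul, L.T_mul_N, Matrix.map_one _ f.map_zero f.map_one]
  N_mul_T j := by
    rw [← quadMatrix_map, ← Matrix.map_mul, ← Matrix.map_mul, ← Matrix.map_add _ f.map_add,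
      L.N_mul_T, Matrix.map_one _ f.map_zero f.map_one]
  quad_mul_N j := by
    rw [← quadMatrix_map, ← Matrix.map_mul, L.quad_mul_N, Matrix.map_zero _ f.map_zero]

theorem nonempty_linearStrand {O : Type*} [CommRing O] [IsLocalRing O] {r m : ℕ}
    (μ : Fin r → Fin r → Fin m → O) (q : Fin r → Prop) (A B : Fin m → Fin r)
    (hB : ∀ t, q (B t)) (hBA : ∀ t k, μ (B t) (A t) k = if k = t then 1 else 0)
    (hq : ∀ i j k, q i → q j → μ i j k ∈ IsLocalRing.maximalIdeal O) :
    Nonempty (LinearStrand μ) := by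
  let St := {x : (w : ℕ) × (w' : ℕ) × (Matrix (Fin r × Fin w) (Fin w') O) ×
    (Matrix (Fin r × Fin w') (Fin m × Fin w) O) //
      quadMatrix μ x.2.2.1 * x.2.2.2 = 1 ∧ ∀ a c y, ¬ q a → x.2.2.2 (a, c) y = 0}
  have hstep := fun x : St => exists_next_matrix μ q A B hB hBA hq x.1.2.2.1 x.1.2.2.2 x.2.1 x.2.2
  choose w'' N' T' S' h1 h2 h3 h4 h5 using hstep
  -- Since W_0 = 0, the first target U ⊗ W_0 is zero and the zero matrix is a section.
  let start : St := ⟨⟨0, 1, 0, 0⟩, by ext x; exact x.2.elim0, by intros; rfl⟩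
  let next : St → St := fun x => ⟨⟨x.1.2.1, w'' x, N' x, S' x⟩, h4 x, h5 x⟩
  let st : ℕ → St := fun j => Nat.rec start (fun _ x => next x) j
  exact ⟨{
    w := fun j => (st j).1.1
    w_zero := rfl
    w_one := rfl
    N := fun j => (st j).1.2.2.1
    S := fun j => (st j).1.2.2.2
    T := fun j => T' (st j)
    quad_mul_S := fun j => (st j).2.1
    T_mul_N := fun j => h1 (st j)
    N_mul_T := fun j => h2 (st j)
    quad_mul_N := fun j => h3 (st j) }⟩

/-! ### From a linear strand to a linear resolution -/

/-- The vector with entries `∑ a, α (a, c) • x a`. -/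
def combVec {K R ι J : Type*} [Field K] [CommRing R] [Algebra K R] [Fintype ι] (x : ι → R)
    (α : ι × J → K) : J → R :=
  fun c => ∑ a, α (a, c) • x a

namespace LinearStrand

variable {K R : Type*} [Field K] [CommRing R] [Algebra K R] {r m : ℕ}
  {μ : Fin r → Fin r → Fin m → K} (L : LinearStrand μ)

/-- The differentials of the linear strand, with the basis of `V` replaced by `x`. -/
def diff (x : Fin r → R) (j : ℕ) : Matrix (Fin (L.w j)) (Fin (L.w (j + 1))) R :=
  fun c y => combVec x (fun z => L.N j z y) c

theorem diff_mulVec_algebraMap (x : Fin r → R) (j : ℕ) (c : Fin (L.w (j + 1)) → K) :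
    L.diff x j *ᵥ (fun y => algebraMap K R (c y)) = combVec x (L.N j *ᵥ c) := by
  ext a
  simp only [diff, combVec, Matrix.mulVec, dotProduct, Finset.sum_mul, Finset.sum_smul]
  rw [Finset.sum_comm]
  refine Finset.sum_congr rfl fun i _ => Finset.sum_congr rfl fun k _ => ?_
  rw [mul_comm, ← Algebra.smul_def, smul_smul, mul_comm]

/-- The remainder is kept explicit: when α is a column of `L.N (j + 1)` the u-part vanishes, and the
remainder is, up to sign, a column of the homotopy in the cone. -/
theorem diff_mulVec_combVec {l : R} {x : Fin r → R} {u : Fin m → R} {h : Fin r → Fin r → R}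
    (hxx : ∀ a b, x a * x b = ∑ k, μ a b k • u k + l * h a b) (j : ℕ)
    (α : Fin r × Fin (L.w (j + 1)) → K) :
    L.diff x j *ᵥ combVec x α = combVec u (quadMatrix μ (L.N j) *ᵥ α) +
      l • fun c => ∑ y, ∑ b, ∑ a, (L.N j (b, c) y * α (a, y)) • h a b := by
  ext c
  have e1 : (L.diff x j *ᵥ combVec x α) c =
      ∑ y, ∑ b, ∑ a, (L.N j (b, c) y * α (a, y)) • (x a * x b) := by
    simp only [diff, combVec, Matrix.mulVec, dotProduct, Finset.sum_mul_sum]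
    refine Finset.sum_congr rfl fun y _ => Finset.sum_congr rfl fun b _ =>
      Finset.sum_congr rfl fun a _ => ?_
    rw [smul_mul_smul_comm, mul_comm (x b)]
  rw [e1]
  simp only [hxx, smul_add, Finset.sum_add_distrib, Pi.add_apply, Pi.smul_apply, smul_eq_mul,
    Finset.mul_sum, mul_smul_comm]
  congr 1
  simp only [combVec, quadMatrix, Matrix.mulVec, dotProduct, Finset.sum_smul, Finset.smul_sum,
    Finset.sum_mul, Fintype.sum_prod_type]
  have e2 : ∀ y, ∑ b, ∑ a, ∑ k, (L.N j (b, c) y * α (a, y)) • μ a b k • u k =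
      ∑ k, ∑ a, ∑ b, (L.N j (b, c) y * α (a, y)) • μ a b k • u k := fun y => by
    rw [Finset.sum_comm]
    simp_rw [Finset.sum_comm (s := Finset.univ (α := Fin r)) (t := Finset.univ (α := Fin m))]
  simp_rw [e2]
  rw [Finset.sum_comm]
  refine Finset.sum_congr rfl fun k _ => ?_
  rw [Finset.sum_comm]
  refine Finset.sum_congr rfl fun a _ => Finset.sum_congr rfl fun y _ =>
    Finset.sum_congr rfl fun b _ => ?_
  rw [smul_smul]
  ring_nf

theorem exists_diff_mulVec_combVec {l : R} {x : Fin r → R} {u : Fin m → R} {h : Fin r → Fin r → R}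
    (hxx : ∀ a b, x a * x b = ∑ k, μ a b k • u k + l * h a b) (j : ℕ)
    (α : Fin r × Fin (L.w (j + 1)) → K) :
    ∃ s, L.diff x j *ᵥ combVec x α = combVec u (quadMatrix μ (L.N j) *ᵥ α) + l • s :=
  ⟨_, L.diff_mulVec_combVec hxx j α⟩

theorem diff_mulVec_combVec_of_dvd {l : R} {x : Fin r → R} {u : Fin m → R}
    (hxu : ∀ a k, ∃ g, x a * u k = l * g) (j : ℕ) (β : Fin m × Fin (L.w (j + 1)) → K) :
    ∃ t, L.diff x j *ᵥ combVec u β = l • t := by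
  choose g hg using hxu
  refine ⟨fun c => ∑ y, ∑ a, ∑ k, (L.N j (a, c) y * β (k, y)) • g a k, ?_⟩
  ext c
  simp only [diff, combVec, Matrix.mulVec, dotProduct, Finset.sum_mul_sum]
  simp only [Pi.smul_apply, smul_eq_mul, Finset.mul_sum]
  refine Finset.sum_congr rfl fun y _ => Finset.sum_congr rfl fun a _ =>
    Finset.sum_congr rfl fun k _ => ?_
  rw [smul_mul_smul_comm, hg, mul_smul_comm]

/-- `hspan` and `hind` say that 1, x_a, u_k form a K-basis of R/(l); `hxx` and `hxu` give its
multiplication. -/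
theorem isKoszul (L : LinearStrand μ) (𝒜 : ℕ → Submodule K R)
    (hmul : ∀ i j x y, x ∈ 𝒜 i → y ∈ 𝒜 j → x * y ∈ 𝒜 (i + j))
    {l : R} (hl : ∀ t, l * t = 0 → t = 0) (hl1 : l ∈ 𝒜 1)
    {x : Fin r → R} (hx : ∀ a, x a ∈ 𝒜 1) {u : Fin m → R} {h : Fin r → Fin r → R}
    (hh : ∀ a b, h a b ∈ 𝒜 1)
    (hirr : irrelevantIdeal 𝒜 ≤ Ideal.span (insert l (Set.range x)))
    (hspan : ∀ t, ∃ (c : K) (α : Fin r → K) (β : Fin m → K) (t' : R),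
      t = algebraMap K R c + ∑ a, α a • x a + ∑ k, β k • u k + l * t')
    (hind : ∀ (c : K) (α : Fin r → K) (β : Fin m → K) (t : R),
      algebraMap K R c + ∑ a, α a • x a + ∑ k, β k • u k = l * t → c = 0 ∧ α = 0 ∧ β = 0)
    (hxx : ∀ a b, x a * x b = ∑ k, μ a b k • u k + l * h a b)
    (hxu : ∀ a k, ∃ g, x a * u k = l * g) :
    IsKoszul 𝒜 := by
  let D := L.diff x
  let H : ∀ j, Matrix (Fin (L.w j)) (Fin (L.w (j + 2))) R := fun j c z =>
    -∑ y, ∑ b, ∑ a, (L.N j (b, c) y * L.N (j + 1) (a, y) z) • h a b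
  have hDmem : ∀ j a b, D j a b ∈ 𝒜 1 := by
    intro j a b
    simp only [D, diff, combVec]
    exact Submodule.sum_mem _ fun i _ => Submodule.smul_mem _ _ (hx i)
  have hHmem : ∀ j a b, H j a b ∈ 𝒜 1 := fun j a b =>
    Submodule.neg_mem _ <| Submodule.sum_mem _ fun _ _ => Submodule.sum_mem _ fun _ _ =>
      Submodule.sum_mem _ fun _ _ => Submodule.smul_mem _ _ (hh _ _)
  have hDH : ∀ j, D j * D (j + 1) = -(l • H j) := by
    intro j
    ext c z
    have h1 := congrFun (L.diff_mulVec_combVec hxx j fun y => L.N (j + 1) y z) c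
    have h2 : quadMatrix μ (L.N j) *ᵥ (fun y => L.N (j + 1) y z) = 0 := by
      ext y
      exact congrFun (congrFun (L.quad_mul_N j) y) z
    rw [h2] at h1
    have h3 : combVec u (0 : Fin m × Fin (L.w j) → K) c = 0 := by simp [combVec]
    rw [Pi.add_apply, h3, zero_add] at h1
    refine Eq.trans h1 ?_
    change _ = -(l * H j c z)
    simp [H]
  -- Modulo l, split v into parts c, α, β of degrees 0, 1, 2. The differential acts on them by N, by
  -- the quadratic map, and by zero. Exactness in these degrees is respectively T N = 1, N T + S ·
  -- quad = 1 and quad · S = 1.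
  have hD : ∀ j v z, D (j + 1) *ᵥ v = l • z → ∃ v' z', v = D (j + 2) *ᵥ v' + l • z' := by
    intro j v z hvz
    choose c α β t ht using fun y => hspan (v y)
    have hv : v = (fun y => algebraMap K R (c y)) + combVec x (fun z => α z.2 z.1) +
        combVec u (fun z => β z.2 z.1) + l • t := by
      ext y
      rw [ht y]
      rfl
    obtain ⟨t1, ht1⟩ := L.diff_mulVec_combVec_of_dvd hxu (j + 1) (fun z => β z.2 z.1)
    obtain ⟨s1, hDv⟩ := L.exists_diff_mulVec_combVec hxx (j + 1) fun z => α z.2 z.1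
    have hDc := L.diff_mulVec_algebraMap x (j + 1) c
    have key : ∃ t2, combVec x (L.N (j + 1) *ᵥ c) +
        combVec u (quadMatrix μ (L.N (j + 1)) *ᵥ fun z => α z.2 z.1) = l • t2 := by
      refine ⟨z - t1 - L.diff x (j + 1) *ᵥ t - s1, ?_⟩
      rw [smul_sub, smul_sub, smul_sub, ← hvz, ← ht1, ← hDc, ← Matrix.mulVec_smul,
        eq_sub_of_add_eq hDv.symm]
      simp only [D]
      rw [hv, Matrix.mulVec_add, Matrix.mulVec_add, Matrix.mulVec_add]
      abel
    obtain ⟨t2, ht2⟩ := key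
    have hzero : ∀ y, _ := fun y => hind 0 (fun a => (L.N (j + 1) *ᵥ c) (a, y))
      (fun k => (quadMatrix μ (L.N (j + 1)) *ᵥ fun z => α z.2 z.1) (k, y)) (t2 y) (by
        rw [map_zero, zero_add]
        exact congrFun ht2 y)
    have hNc : L.N (j + 1) *ᵥ c = 0 := by
      ext ⟨a, y⟩
      exact congrFun (hzero y).2.1 a
    have hΦ : (quadMatrix μ (L.N (j + 1)) *ᵥ fun z => α z.2 z.1) = 0 := by
      ext ⟨a, y⟩
      exact congrFun (hzero y).2.2 a
    have hc : c = 0 := by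
      have := congrArg (L.T j *ᵥ ·) hNc
      simpa [Matrix.mulVec_mulVec, L.T_mul_N] using this
    have hα : (fun z => α z.2 z.1) = L.N (j + 2) *ᵥ (L.T (j + 1) *ᵥ fun z => α z.2 z.1) := by
      have := congrArg (· *ᵥ fun z => α z.2 z.1) (L.N_mul_T (j + 1))
      simp only [Matrix.add_mulVec, ← Matrix.mulVec_mulVec, hΦ, Matrix.mulVec_zero, add_zero,
        Matrix.one_mulVec] at this
      exact this.symm
    have h1 := L.diff_mulVec_algebraMap x (j + 2) (L.T (j + 1) *ᵥ fun z => α z.2 z.1)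
    rw [← hα] at h1
    obtain ⟨s2, h2⟩ := L.exists_diff_mulVec_combVec hxx (j + 2)
      (L.S (j + 2) *ᵥ fun z => β z.2 z.1)
    rw [Matrix.mulVec_mulVec, L.quad_mul_S, Matrix.one_mulVec] at h2
    refine ⟨(fun y => algebraMap K R ((L.T (j + 1) *ᵥ fun z => α z.2 z.1) y)) +
      combVec x (L.S (j + 2) *ᵥ fun z => β z.2 z.1), t - s2, ?_⟩
    simp only [D]
    rw [Matrix.mulVec_add, h1, h2, smul_sub]
    have h0 : (fun y => algebraMap K R (c y)) = 0 := by
      ext y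
      simp [hc]
    rw [hv, h0]
    abel
  have hMmem : ∀ i a b, coneMatrix l (D (i + 1)) (D i) (H i) a b ∈ 𝒜 1 := by
    rintro i (a | a) (b | b)
    · exact hDmem _ _ _
    · simp only [coneMatrix, Matrix.fromBlocks_apply₁₂, Matrix.smul_apply, Matrix.one_apply]
      split_ifs <;> simp [hl1]
    · exact hHmem _ _ _
    · simp only [coneMatrix, Matrix.fromBlocks_apply₂₂, Matrix.neg_apply]
      exact Submodule.neg_mem _ (hDmem _ _ _)
  refine isKoszul_of_linear_resolution 𝒜 hmul (fun i => Fin (L.w (i + 1)) ⊕ Fin (L.w i))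
    (by simp [L.w_zero, L.w_one]) (fun i => coneMatrix l (D (i + 1)) (D i) (H i)) hMmem
    (fun i => coneMatrix_exact hl L.w D H hDH hD i) fun v => ⟨fun hv => ?_, ?_⟩
  · have hempty : IsEmpty (Fin (L.w 0)) := by rw [L.w_zero]; infer_instance
    have hsub : Subsingleton (Fin (L.w 1)) := by rw [L.w_one]; infer_instance
    have hone : Nonempty (Fin (L.w 1)) := by rw [L.w_one]; infer_instance
    obtain ⟨a0⟩ := hone
    let P : Ideal R := (LinearMap.range (coneMatrix l (D 1) (D 0) (H 0)).mulVecLin).comap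
      (LinearMap.pi fun _ => LinearMap.id)
    have hP : irrelevantIdeal 𝒜 ≤ P := by
      refine hirr.trans (Ideal.span_le.2 ?_)
      rintro _ (rfl | ⟨a, rfl⟩)
      · refine ⟨Sum.elim 0 fun _ => 1, ?_⟩
        ext (c | c)
        · simp [coneMatrix, Matrix.fromBlocks_mulVec, Matrix.smul_mulVec]
        · exact hempty.elim c
      -- Because W_0 = 0, `N_mul_T 0` reads N_1 T_0 = 1, so a column of T_0 is a preimage of x_a.
      · have h1 := L.diff_mulVec_algebraMap x 1 fun y => L.T 0 y (a, a0)
        have h2 : L.N 1 *ᵥ (fun y => L.T 0 y (a, a0)) = Pi.single (a, a0) 1 := by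
          have h3 := L.N_mul_T 0
          have h4 : L.S 0 * quadMatrix μ (L.N 0) = 0 := by
            ext y z
            rw [Matrix.mul_apply]
            exact Finset.sum_eq_zero fun b _ => hempty.elim b.2
          rw [h4, add_zero] at h3
          ext y
          refine (congrFun (congrFun h3 y) (a, a0)).trans ?_
          simp [Matrix.one_apply, Pi.single_apply]
        refine ⟨Sum.elim (fun y => algebraMap K R (L.T 0 y (a, a0))) 0, ?_⟩
        ext (c | c)
        · obtain rfl : c = a0 := Subsingleton.elim _ _
          have h5 := congrFun h1 c
          rw [h2] at h5
          simp only [Matrix.mulVecLin_apply, coneMatrix, Matrix.fromBlocks_mulVec]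
          simp only [Sum.elim_inl, Sum.elim_comp_inl, Sum.elim_comp_inr, Matrix.mulVec_zero,
            add_zero]
          refine Eq.trans h5 ?_
          simp [combVec, Pi.single_apply]
        · exact hempty.elim c
    have hmem : v (Sum.inl a0) ∈ P := hP (hv (Sum.inl a0))
    obtain ⟨w, hw⟩ := LinearMap.mem_range.1 (Submodule.mem_comap.1 hmem)
    refine ⟨w, ?_⟩
    ext (c | c)
    · obtain rfl : c = a0 := Subsingleton.elim _ _
      exact congrFun hw (Sum.inl c)
    · exact hempty.elim c
  · rintro ⟨w, rfl⟩ a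
    rw [Matrix.mulVec, dotProduct]
    refine Ideal.sum_mem _ fun b _ => Ideal.mul_mem_right _ _ ?_
    exact Ideal.subset_span ⟨1, one_pos, hMmem 0 a b⟩

end LinearStrand

/-! ### The homogeneous coordinate ring inside a product of polynomial rings -/

open MvPolynomial in
/-- Restriction of polynomials to the line through `w`: `x_j ↦ w_j T`. -/
noncomputable def evalLine {K σ : Type*} [Field K] (w : σ → K) :
    MvPolynomial σ K →ₐ[K] Polynomial K :=
  aeval fun j => Polynomial.monomial 1 (w j)

section evalLine

variable {K σ : Type*} [Field K]

theorem evalLine_monomial (w : σ → K) (e : σ →₀ ℕ) (a : K) :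
    evalLine w (MvPolynomial.monomial e a) =
      Polynomial.monomial e.degree (MvPolynomial.eval w (MvPolynomial.monomial e a)) := by
  rw [evalLine, MvPolynomial.aeval_monomial, MvPolynomial.eval_monomial]
  simp only [Polynomial.monomial_pow, one_mul, Finsupp.prod, Finsupp.degree]
  have : ∀ s : Finset σ, ∏ x ∈ s, Polynomial.monomial (e x) (w x ^ e x) =
      Polynomial.monomial (∑ x ∈ s, e x) (∏ x ∈ s, w x ^ e x) := by
    classical
    intro s
    induction s using Finset.induction_on with
    | empty => simp
    | insert b s hb ih =>
      rw [Finset.prod_insert hb, ih, Polynomial.monomial_mul_monomial, Finset.sum_insert hb,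
        Finset.prod_insert hb]
  rw [this, Polynomial.algebraMap_eq, Polynomial.C_mul_monomial]
  rfl

theorem evalLine_of_isHomogeneous (w : σ → K) {f : MvPolynomial σ K} {d : ℕ}
    (hf : f.IsHomogeneous d) : evalLine w f = Polynomial.monomial d (MvPolynomial.eval w f) := by
  conv_lhs => rw [f.as_sum]
  conv_rhs => rw [f.as_sum]
  rw [map_sum, map_sum, map_sum]
  refine Finset.sum_congr rfl fun e he => ?_
  rw [evalLine_monomial, hf.degree_eq_sum_deg_support he]
  rfl

theorem evalLine_homogeneousComponent (w : σ → K) (f : MvPolynomial σ K) (d : ℕ) :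
    evalLine w (MvPolynomial.homogeneousComponent d f) =
      Polynomial.monomial d ((evalLine w f).coeff d) := by
  rw [evalLine_of_isHomogeneous w (MvPolynomial.homogeneousComponent_isHomogeneous d f)]
  congr 1
  conv_rhs => rw [← MvPolynomial.sum_homogeneousComponent f]
  rw [map_sum, Polynomial.finsetSum_coeff]
  simp only [evalLine_of_isHomogeneous w (MvPolynomial.homogeneousComponent_isHomogeneous _ f),
    Polynomial.coeff_monomial]
  rw [Finset.sum_ite_eq' (Finset.range (f.totalDegree + 1)) d]
  split_ifs with h
  · rfl
  · rw [MvPolynomial.homogeneousComponent_eq_zero _ _ (by simpa using h), map_zero]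

theorem evalLine_smul_eq_zero_iff (w : σ → K) {f : MvPolynomial σ K} {d : ℕ}
    (hf : f.IsHomogeneous d) (a : Kˣ) :
    MvPolynomial.eval (a • w) f = 0 ↔ MvPolynomial.eval w f = 0 := by
  have : MvPolynomial.eval (a • w) f = (a : K) ^ d * MvPolynomial.eval w f := by
    conv_lhs => rw [f.as_sum]
    conv_rhs => rw [f.as_sum]
    rw [map_sum, map_sum, Finset.mul_sum]
    refine Finset.sum_congr rfl fun e he => ?_
    rw [MvPolynomial.eval_monomial, MvPolynomial.eval_monomial,
      hf.degree_eq_sum_deg_support he]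
    simp only [Finsupp.prod, Pi.smul_apply, Units.smul_def, smul_eq_mul, mul_pow,
      Finset.prod_mul_distrib, Finset.prod_pow_eq_pow_sum]
    ring
  rw [this, mul_eq_zero, or_iff_right (pow_ne_zero _ a.ne_zero)]

end evalLine

/-- `v` chooses homogeneous coordinates for all points of `X`. -/
def IsCoords {K : Type*} [Field K] {n : ℕ} {X : Set (Projectivization K (Fin (n + 1) → K))}
    (v : X → Fin (n + 1) → K) : Prop :=
  ∀ p : X, ∃ h : v p ≠ 0, Projectivization.mk K (v p) h = p

section CoordRing

variable {K : Type*} [Field K] {n : ℕ} {X : Set (Projectivization K (Fin (n + 1) → K))}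
  {v : X → Fin (n + 1) → K}

theorem eval_rep_eq_zero_iff (hv : IsCoords v) (p : X) {f : MvPolynomial (Fin (n + 1)) K} {d : ℕ}
    (hf : f.IsHomogeneous d) :
    MvPolynomial.eval p.1.rep f = 0 ↔ MvPolynomial.eval (v p) f = 0 := by
  obtain ⟨h, hp⟩ := hv p
  obtain ⟨a, ha⟩ := Projectivization.exists_smul_eq_mk_rep K (v p) h
  rw [hp] at ha
  rw [← ha, evalLine_smul_eq_zero_iff (v p) hf]

/-- The degree d component of f restricts to the T^d term on each line, so f vanishes on the lines
exactly when its components vanish at the points. Thus R(X) embeds in a product of copies of K[T]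
compatibly with degrees, and identities in R(X) can be checked there. -/
theorem mem_projVanishingIdeal_iff (hv : IsCoords v) (f : MvPolynomial (Fin (n + 1)) K) :
    f ∈ projVanishingIdeal X ↔ ∀ p, evalLine (v p) f = 0 := by
  constructor
  · intro hf p
    have : projVanishingIdeal X ≤ RingHom.ker (evalLine (v p)) := by
      refine Ideal.span_le.2 ?_
      rintro g ⟨⟨d, hd⟩, hg⟩
      change evalLine (v p) g = 0
      rw [evalLine_of_isHomogeneous _ hd, (eval_rep_eq_zero_iff hv p hd).1 (hg p p.2), map_zero]
    exact this hf
  · intro hf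
    rw [← MvPolynomial.sum_homogeneousComponent f]
    refine Ideal.sum_mem _ fun d _ => Ideal.subset_span ⟨⟨d, ?_⟩, fun p hp => ?_⟩
    · exact MvPolynomial.homogeneousComponent_isHomogeneous d f
    · rw [eval_rep_eq_zero_iff hv ⟨p, hp⟩ (MvPolynomial.homogeneousComponent_isHomogeneous d f)]
      have := evalLine_homogeneousComponent (v ⟨p, hp⟩) f d
      rw [hf, Polynomial.coeff_zero, map_zero, evalLine_of_isHomogeneous _
        (MvPolynomial.homogeneousComponent_isHomogeneous d f), Polynomial.monomial_eq_zero_iff]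
        at this
      exact this

namespace CoordRing

/-- Restriction of an element of the coordinate ring to the line through `v p`. -/
noncomputable def evalAt (hv : IsCoords v) (p : X) : CoordRing X →ₐ[K] Polynomial K :=
  Ideal.Quotient.liftₐ _ (evalLine (v p)) fun f hf => (mem_projVanishingIdeal_iff hv f).1 hf p

/-- The quotient map onto the coordinate ring. -/
noncomputable def mk (X : Set (Projectivization K (Fin (n + 1) → K))) :
    MvPolynomial (Fin (n + 1)) K →ₐ[K] CoordRing X :=
  Ideal.Quotient.mkₐ K (projVanishingIdeal X)

theorem mk_surjective : Function.Surjective (mk X) := Ideal.Quotient.mkₐ_surjective _ _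

/-- The class of the variable `x_j`. -/
noncomputable def var (X : Set (Projectivization K (Fin (n + 1) → K))) (j : Fin (n + 1)) :
    CoordRing X :=
  mk X (MvPolynomial.X j)

@[simp]
theorem evalAt_mk (hv : IsCoords v) (p : X) (f : MvPolynomial (Fin (n + 1)) K) :
    evalAt hv p (mk X f) = evalLine (v p) f := rfl

@[simp]
theorem evalAt_var (hv : IsCoords v) (p : X) (j : Fin (n + 1)) :
    evalAt hv p (var X j) = Polynomial.monomial 1 (v p j) := by
  simp [var, evalLine]

theorem mk_eq_zero_iff (f : MvPolynomial (Fin (n + 1)) K) :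
    mk X f = 0 ↔ f ∈ projVanishingIdeal X :=
  Ideal.Quotient.eq_zero_iff_mem

theorem ext_evalAt (hv : IsCoords v) {r s : CoordRing X} (h : ∀ p, evalAt hv p r = evalAt hv p s) :
    r = s := by
  rw [← sub_eq_zero]
  obtain ⟨f, hf⟩ := mk_surjective (r - s)
  rw [← hf, mk_eq_zero_iff, mem_projVanishingIdeal_iff hv]
  intro p
  rw [← evalAt_mk hv, hf, map_sub, h, sub_self]

theorem mem_grading_iff {d : ℕ} {r : CoordRing X} :
    r ∈ grading X d ↔ ∃ f : MvPolynomial (Fin (n + 1)) K, f.IsHomogeneous d ∧ mk X f = r :=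
  Iff.rfl

theorem evalAt_of_mem (hv : IsCoords v) {d : ℕ} {r : CoordRing X} (hr : r ∈ grading X d) (p : X) :
    evalAt hv p r = Polynomial.monomial d ((evalAt hv p r).coeff d) := by
  obtain ⟨f, hf, rfl⟩ := mem_grading_iff.1 hr
  rw [evalAt_mk, evalLine_of_isHomogeneous _ hf, Polynomial.coeff_monomial, if_pos rfl]

/-- The component of degree `d` of an element of the coordinate ring. -/
noncomputable def comp (X : Set (Projectivization K (Fin (n + 1) → K))) (d : ℕ)
    (r : CoordRing X) : CoordRing X :=
  mk X (MvPolynomial.homogeneousComponent d (Function.surjInv mk_surjective r))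

theorem comp_mem (d : ℕ) (r : CoordRing X) : comp X d r ∈ grading X d :=
  mem_grading_iff.2 ⟨_, MvPolynomial.homogeneousComponent_isHomogeneous _ _, rfl⟩

@[simp]
theorem evalAt_comp (hv : IsCoords v) (d : ℕ) (r : CoordRing X) (p : X) :
    evalAt hv p (comp X d r) = Polynomial.monomial d ((evalAt hv p r).coeff d) := by
  rw [comp, evalAt_mk, evalLine_homogeneousComponent, ← evalAt_mk hv,
    Function.surjInv_eq mk_surjective]

theorem comp_of_mem (hv : IsCoords v) {d : ℕ} {r : CoordRing X} (hr : r ∈ grading X d) :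
    comp X d r = r :=
  ext_evalAt hv fun p => by rw [evalAt_comp, ← evalAt_of_mem hv hr]

theorem comp_mul_of_mem (hv : IsCoords v) {d e : ℕ} {s : CoordRing X} (hs : s ∈ grading X e)
    (r : CoordRing X) :
    comp X (d + e) (r * s) = comp X d r * s :=
  ext_evalAt hv fun p => by
    rw [evalAt_comp, map_mul, map_mul, evalAt_comp, evalAt_of_mem hv hs,
      Polynomial.monomial_mul_monomial, Polynomial.coeff_mul_monomial]

theorem comp_sum (hv : IsCoords v) {ι : Type*} (s : Finset ι) (d : ℕ) (f : ι → CoordRing X) :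
    comp X d (∑ i ∈ s, f i) = ∑ i ∈ s, comp X d (f i) :=
  ext_evalAt hv fun p => by simp [Polynomial.finsetSum_coeff]

theorem mul_mem_grading {d e : ℕ} {r s : CoordRing X} (hr : r ∈ grading X d)
    (hs : s ∈ grading X e) : r * s ∈ grading X (d + e) := by
  obtain ⟨f, hf, rfl⟩ := mem_grading_iff.1 hr
  obtain ⟨g, hg, rfl⟩ := mem_grading_iff.1 hs
  exact mem_grading_iff.2 ⟨f * g, hf.mul hg, map_mul _ _ _⟩

theorem var_mem (j : Fin (n + 1)) : var X j ∈ grading X 1 :=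
  mem_grading_iff.2 ⟨_, MvPolynomial.isHomogeneous_X _ _, rfl⟩

theorem mem_grading_zero_iff {r : CoordRing X} :
    r ∈ grading X 0 ↔ ∃ c, algebraMap K (CoordRing X) c = r := by
  rw [grading, MvPolynomial.homogeneousSubmodule_zero]
  simp only [Submodule.mem_map, Submodule.mem_one]
  constructor
  · rintro ⟨_, ⟨c, rfl⟩, rfl⟩
    exact ⟨c, rfl⟩
  · rintro ⟨c, rfl⟩
    exact ⟨_, ⟨c, rfl⟩, rfl⟩

theorem grading_one_eq_span : grading X 1 = Submodule.span K (Set.range (var X)) := by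
  rw [grading, MvPolynomial.homogeneousSubmodule_one_eq_span_X, Submodule.map_span,
    ← Set.range_comp]
  rfl

theorem mem_grading_one_iff {r : CoordRing X} :
    r ∈ grading X 1 ↔ ∃ γ : Fin (n + 1) → K, ∑ j, γ j • var X j = r := by
  rw [grading_one_eq_span, Submodule.mem_span_range_iff_exists_fun]

theorem mul_left_cancel_of_ne_zero (hv : IsCoords v) {l : CoordRing X}
    (hl0 : ∀ p, evalAt hv p l ≠ 0) {t : CoordRing X} (ht : l * t = 0) : t = 0 := by
  refine ext_evalAt hv fun p => ?_
  have := congrArg (evalAt hv p) ht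
  rw [map_mul, map_zero, mul_eq_zero, or_iff_right (hl0 p)] at this
  rw [this, map_zero]

end CoordRing

end CoordRing

/-! ### Koszulness from interpolation by quadrics -/

/-- The values at the points `y` of the quadrics `x_0 ^ 2`, `x_0 x_i` and `x_{A t} x_{B t}`. -/
def quadricMatrix {O : Type*} [CommRing O] {n r m : ℕ} (c : Fin r → Fin (n + 1))
    (A B : Fin m → Fin r) (y : Unit ⊕ Fin r ⊕ Fin m → Fin (n + 1) → O) :
    Matrix (Unit ⊕ Fin r ⊕ Fin m) (Unit ⊕ Fin r ⊕ Fin m) O :=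
  fun p => Sum.elim (fun _ => y p 0 * y p 0)
    (Sum.elim (fun i => y p 0 * y p (c i)) fun t => y p (c (A t)) * y p (c (B t)))

theorem quadricMatrix_mulVec {O : Type*} [CommRing O] {n r m : ℕ} (c : Fin r → Fin (n + 1))
    (A B : Fin m → Fin r) (y : Unit ⊕ Fin r ⊕ Fin m → Fin (n + 1) → O)
    (γ : Unit ⊕ Fin r ⊕ Fin m → O) (p) :
    (quadricMatrix c A B y *ᵥ γ) p = y p 0 * y p 0 * γ (Sum.inl ()) +
      (∑ i, y p 0 * y p (c i) * γ (Sum.inr (Sum.inl i)) +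
      ∑ t, y p (c (A t)) * y p (c (B t)) * γ (Sum.inr (Sum.inr t))) := by
  simp [Matrix.mulVec, dotProduct, quadricMatrix]

theorem Matrix.exists_mulVec_eq_of_isUnit {J O : Type*} [Fintype J] [DecidableEq J] [CommRing O]
    {M : Matrix J J O} (hM : IsUnit M) (g : J → O) : ∃ γ, M *ᵥ γ = g := by
  obtain ⟨N, hN⟩ := hM.exists_right_inv
  exact ⟨N *ᵥ g, by rw [Matrix.mulVec_mulVec, hN, Matrix.one_mulVec]⟩

theorem Matrix.eq_zero_of_mulVec_of_isUnit {J O : Type*} [Fintype J] [DecidableEq J] [CommRing O]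
    {M : Matrix J J O} (hM : IsUnit M) {g : J → O} (h : M *ᵥ g = 0) : g = 0 := by
  obtain ⟨N, hN⟩ := hM.exists_left_inv
  rw [← Matrix.one_mulVec g, ← hN, ← Matrix.mulVec_mulVec, h, Matrix.mulVec_zero]

namespace CoordRing

variable {K : Type*} [Field K] {n : ℕ} {X : Set (Projectivization K (Fin (n + 1) → K))}
  {v : X → Fin (n + 1) → K}

theorem evalAt_var_mul_var (hv : IsCoords v) (p : X) (i j : Fin (n + 1)) :
    evalAt hv p (var X i * var X j) = Polynomial.monomial 2 (v p i * v p j) := by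
  rw [map_mul, evalAt_var, evalAt_var, Polynomial.monomial_mul_monomial]

/-- Invertibility of the matrix says that the listed quadrics interpolate any values at X, uniquely.
Existence yields the multiplication table modulo x_0; uniqueness yields independence modulo x_0. -/
theorem isKoszul_of_linearStrand (hv : IsCoords v) {r m : ℕ} (e : Unit ⊕ Fin r ⊕ Fin m ≃ X)
    (c : Fin r → Fin (n + 1)) (A B : Fin m → Fin r)
    (hcov : ∀ j, j = 0 ∨ j ∈ Set.range c ∨ m = 0)
    (hM : IsUnit (quadricMatrix c A B fun j => v (e j))) (h0 : ∀ p, v p 0 ≠ 0)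
    {μ : Fin r → Fin r → Fin m → K} (L : LinearStrand μ)
    (hμ : ∀ a b, ∃ γ, (∀ t, γ (Sum.inr (Sum.inr t)) = μ a b t) ∧
      (quadricMatrix c A B fun j => v (e j)) *ᵥ γ = fun j => v (e j) (c a) * v (e j) (c b)) :
    IsKoszul (grading X) := by
  have hvar : ∀ j, ∃ (a0 : K) (a : Fin r → K),
      var X j = a0 • var X 0 + ∑ i, a i • var X (c i) := by
    intro j
    rcases hcov j with rfl | ⟨i, rfl⟩ | rfl
    · exact ⟨1, 0, by simp⟩
    · exact ⟨0, Pi.single i 1, by simp [Pi.single_apply]⟩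
    -- When m = 0 all the interpolating quadrics are divisible by x_0; interpolate x_0 x_j and
    -- cancel x_0.
    · obtain ⟨γ, hγ⟩ := Matrix.exists_mulVec_eq_of_isUnit hM fun p => v (e p) 0 * v (e p) j
      refine ⟨γ (Sum.inl ()), fun i => γ (Sum.inr (Sum.inl i)), ext_evalAt hv fun p => ?_⟩
      obtain ⟨p, rfl⟩ := e.surjective p
      have h1 := congrFun hγ p
      rw [quadricMatrix_mulVec] at h1
      have h2 : v (e p) j = v (e p) 0 * γ (Sum.inl ()) +
          ∑ i, v (e p) (c i) * γ (Sum.inr (Sum.inl i)) := by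
        refine mul_left_cancel₀ (h0 (e p)) ?_
        rw [← h1, mul_add, Finset.mul_sum]
        simp [mul_assoc]
      rw [evalAt_var, h2]
      simp [mul_comm, Polynomial.smul_monomial]
  have hlin : ∀ γ : Fin (n + 1) → K, ∃ (a0 : K) (a : Fin r → K),
      ∑ j, γ j • var X j = a0 • var X 0 + ∑ i, a i • var X (c i) := by
    intro γ
    choose a0 a ha using hvar
    refine ⟨∑ j, γ j * a0 j, fun i => ∑ j, γ j * a j i, ?_⟩
    rw [Finset.sum_congr rfl fun j _ => congrArg (γ j • ·) (ha j)]
    simp only [smul_add, Finset.smul_sum, smul_smul, Finset.sum_add_distrib, Finset.sum_smul]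
    rw [Finset.sum_comm (s := Finset.univ (α := Fin (n + 1)))]
  choose γ hγ1 hγ2 using hμ
  have hxx : ∀ a b, var X (c a) * var X (c b) =
      ∑ k, μ a b k • (var X (c (A k)) * var X (c (B k))) +
        var X 0 * (γ a b (Sum.inl ()) • var X 0 +
          ∑ i, γ a b (Sum.inr (Sum.inl i)) • var X (c i)) := by
    intro a b
    refine ext_evalAt hv fun p => ?_
    obtain ⟨p, rfl⟩ := e.surjective p
    have h1 := congrFun (hγ2 a b) p
    rw [quadricMatrix_mulVec] at h1
    simp only [mul_add, Finset.mul_sum, mul_smul_comm, map_add, map_smul, map_sum,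
      evalAt_var_mul_var, Polynomial.smul_monomial, smul_eq_mul]
    simp only [← map_sum, ← map_add]
    rw [← h1]
    congr 1
    simp only [hγ1, mul_comm _ (γ a b _), mul_comm _ (μ a b _)]
    ring
  have hxu : ∀ a k, ∃ g, var X (c a) * (var X (c (A k)) * var X (c (B k))) = var X 0 * g := by
    intro a k
    -- A quadric g interpolates the cubic's values divided by x_0; the cubic then equals x_0 g in
    -- R(X).
    obtain ⟨δ, hδ⟩ := Matrix.exists_mulVec_eq_of_isUnit hM fun p =>
      v (e p) (c a) * (v (e p) (c (A k)) * v (e p) (c (B k))) / v (e p) 0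
    refine ⟨δ (Sum.inl ()) • (var X 0 * var X 0) +
      (∑ i, δ (Sum.inr (Sum.inl i)) • (var X 0 * var X (c i)) +
        ∑ t, δ (Sum.inr (Sum.inr t)) • (var X (c (A t)) * var X (c (B t)))),
      ext_evalAt hv fun p => ?_⟩
    obtain ⟨p, rfl⟩ := e.surjective p
    have h1 := congrFun hδ p
    rw [quadricMatrix_mulVec, eq_div_iff (h0 _)] at h1
    rw [map_mul, map_mul (evalAt hv (e p)) (var X 0)]
    simp only [map_add, map_smul, map_sum,
      evalAt_var_mul_var, Polynomial.smul_monomial, smul_eq_mul]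
    simp only [← map_sum, ← map_add, evalAt_var, Polynomial.monomial_mul_monomial]
    rw [← h1]
    congr 1
    rw [mul_comm]
    simp only [mul_comm _ (δ _)]
  refine L.isKoszul (grading X) (fun i j x y => mul_mem_grading) (l := var X 0) ?_ (var_mem 0)
    (fun a => var_mem (c a)) (u := fun k => var X (c (A k)) * var X (c (B k)))
    (h := fun a b => γ a b (Sum.inl ()) • var X 0 +
      ∑ i, γ a b (Sum.inr (Sum.inl i)) • var X (c i)) ?_ ?_ ?_ ?_ hxx hxu
  · exact fun t => mul_left_cancel_of_ne_zero hv fun p => by simpa using h0 p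
  · exact fun a b => Submodule.add_mem _ (Submodule.smul_mem _ _ (var_mem 0))
      (Submodule.sum_mem _ fun i _ => Submodule.smul_mem _ _ (var_mem _))
  · have hle : Ideal.span (MvPolynomial.X '' Set.univ) ≤
        (Ideal.span (insert (var X 0) (Set.range fun a => var X (c a)))).comap (mk X) := by
      refine Ideal.span_le.2 ?_
      rintro _ ⟨j, -, rfl⟩
      obtain ⟨a0, a, ha⟩ := hvar j
      change var X j ∈ Ideal.span (insert (var X 0) (Set.range fun a => var X (c a)))
      rw [ha]
      have hs : ∀ (k : K) {y : CoordRing X}, y ∈ insert (var X 0) (Set.range fun a => var X (c a)) →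
          k • y ∈ Ideal.span (insert (var X 0) (Set.range fun a => var X (c a))) := by
        intro k y hy
        exact Submodule.smul_of_tower_mem _ k (Ideal.subset_span hy)
      exact Ideal.add_mem _ (hs _ (Set.mem_insert _ _))
        (Ideal.sum_mem _ fun i _ => hs _ (Set.mem_insert_of_mem _ ⟨i, rfl⟩))
    refine Ideal.span_le.2 ?_
    rintro y ⟨i, hi, hy⟩
    obtain ⟨f, hf, rfl⟩ := mem_grading_iff.1 hy
    refine hle (MvPolynomial.mem_ideal_span_X_image.2 fun s hs => ?_)
    by_contra! h
    have h1 := hf.degree_eq_sum_deg_support hs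
    rw [Finset.sum_eq_zero fun j _ => h j (Set.mem_univ j)] at h1
    omega
  -- S contains 1 and is stable under every variable, hence is the whole ring.
  · let S : Submodule K (CoordRing X) := Submodule.span K {1} ⊔
      Submodule.span K (Set.range fun a => var X (c a)) ⊔
      Submodule.span K (Set.range fun k => var X (c (A k)) * var X (c (B k))) ⊔
      LinearMap.range (LinearMap.mulLeft K (var X 0))
    have hSl : ∀ t, var X 0 * t ∈ S := fun t => Submodule.mem_sup_right ⟨t, rfl⟩
    have hSu : ∀ k, var X (c (A k)) * var X (c (B k)) ∈ S := fun k =>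
      Submodule.mem_sup_left (Submodule.mem_sup_right (Submodule.subset_span ⟨k, rfl⟩))
    have hSx : ∀ a, var X (c a) ∈ S := fun a => Submodule.mem_sup_left
      (Submodule.mem_sup_left (Submodule.mem_sup_right (Submodule.subset_span ⟨a, rfl⟩)))
    have hS1 : (1 : CoordRing X) ∈ S := Submodule.mem_sup_left (Submodule.mem_sup_left
      (Submodule.mem_sup_left (Submodule.subset_span rfl)))
    have hmulx : ∀ a, S ≤ S.comap (LinearMap.mulLeft K (var X (c a))) := by
      intro a
      refine sup_le (sup_le (sup_le ?_ ?_) ?_) ?_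
      · rw [Submodule.span_le, Set.singleton_subset_iff]
        simpa using hSx a
      · rw [Submodule.span_le]
        rintro _ ⟨b, rfl⟩
        change var X (c a) * var X (c b) ∈ S
        rw [hxx]
        exact S.add_mem (S.sum_mem fun k _ => S.smul_mem _ (hSu k)) (hSl _)
      · rw [Submodule.span_le]
        rintro _ ⟨k, rfl⟩
        obtain ⟨g, hg⟩ := hxu a k
        change var X (c a) * (var X (c (A k)) * var X (c (B k))) ∈ S
        rw [hg]
        exact hSl g
      · rintro _ ⟨t, rfl⟩
        change var X (c a) * (var X 0 * t) ∈ S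
        rw [mul_left_comm]
        exact hSl _
    have hmul : ∀ j t, t ∈ S → var X j * t ∈ S := by
      intro j t ht
      obtain ⟨a0, a, ha⟩ := hvar j
      rw [ha, add_mul, Finset.sum_mul]
      simp only [smul_mul_assoc]
      exact S.add_mem (S.smul_mem _ (hSl t))
        (S.sum_mem fun i _ => S.smul_mem _ (hmulx i ht))
    have htop : ∀ t, t ∈ S := by
      intro t
      obtain ⟨f, rfl⟩ := mk_surjective t
      induction f using MvPolynomial.induction_on with
      | C k =>
        have := S.smul_mem k hS1
        rwa [← Algebra.algebraMap_eq_smul_one, ← AlgHom.commutes (mk X)] at this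
      | add f g hf hg => rw [map_add]; exact S.add_mem hf hg
      | mul_X f j hf => rw [map_mul, mul_comm]; exact hmul j _ hf
    intro t
    obtain ⟨y, hy, _, ⟨t', rfl⟩, rfl⟩ := Submodule.mem_sup.1 (htop t)
    obtain ⟨y, hy1, z, hz, rfl⟩ := Submodule.mem_sup.1 hy
    obtain ⟨y, hy2, w, hw, rfl⟩ := Submodule.mem_sup.1 hy1
    obtain ⟨k, rfl⟩ := Submodule.mem_span_singleton.1 hy2
    obtain ⟨α, rfl⟩ := (Submodule.mem_span_range_iff_exists_fun K).1 hw
    obtain ⟨β, rfl⟩ := (Submodule.mem_span_range_iff_exists_fun K).1 hz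
    exact ⟨k, α, β, t', by rw [Algebra.algebraMap_eq_smul_one]; rfl⟩
  · intro k α β t h
    -- Compare coefficients of T^0, T^1, T^2, where only the components of t in degrees 0 and 1
    -- enter. The degree one relation is later multiplied by x_0 to become a relation among the
    -- interpolating quadrics.
    obtain ⟨g0, hg0⟩ := mem_grading_zero_iff.1 (comp_mem 0 t)
    obtain ⟨γ, hγ⟩ := mem_grading_one_iff.1 (comp_mem 1 t)
    obtain ⟨a0, a, ha⟩ := hlin γ
    have hco : ∀ p d, (evalAt hv p (algebraMap K _ k + ∑ a, α a • var X (c a) +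
        ∑ i, β i • (var X (c (A i)) * var X (c (B i))))).coeff d =
        (evalAt hv p (var X 0 * t)).coeff d := fun p d => by rw [h]
    have hk : k = 0 := by
      have h1 := hco (e (Sum.inl ())) 0
      simpa [Polynomial.coeff_monomial, Polynomial.mul_coeff_zero, Polynomial.monomial_pow,
        Polynomial.monomial_mul_monomial, Polynomial.finsetSum_coeff] using h1
    have h0' : ∀ p, (evalAt hv p t).coeff 0 = g0 := fun p => by
      have := congrArg (evalAt hv p) hg0
      rw [evalAt_comp, AlgHom.commutes] at this
      simpa using (congrArg (Polynomial.coeff · 0) this).symm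
    have h1' : ∀ p, (evalAt hv p t).coeff 1 = a0 * v p 0 + ∑ i, a i * v p (c i) := fun p => by
      have := congrArg (evalAt hv p) (ha.symm.trans hγ)
      rw [evalAt_comp] at this
      simpa [Polynomial.finsetSum_coeff] using (congrArg (Polynomial.coeff · 1) this).symm
    have hc1 : ∀ p, ∑ i, α i * v p (c i) = v p 0 * g0 := fun p => by
      have h1 := hco p (0 + 1)
      rw [map_mul (evalAt hv p) (var X 0) t, evalAt_var, Polynomial.coeff_monomial_mul, h0'] at h1
      simpa [Polynomial.coeff_monomial, Polynomial.coeff_C,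
        Polynomial.monomial_mul_monomial, Polynomial.finsetSum_coeff] using h1
    have hc2 : ∀ p, ∑ i, β i * (v p (c (A i)) * v p (c (B i))) =
        v p 0 * (a0 * v p 0 + ∑ i, a i * v p (c i)) := fun p => by
      have h1 := hco p (1 + 1)
      rw [map_mul (evalAt hv p) (var X 0) t, evalAt_var, Polynomial.coeff_monomial_mul, h1'] at h1
      simpa [Polynomial.coeff_monomial, Polynomial.coeff_C,
        Polynomial.monomial_mul_monomial, Polynomial.finsetSum_coeff] using h1
    refine ⟨hk, ?_, ?_⟩
    · have := Matrix.eq_zero_of_mulVec_of_isUnit hM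
        (g := Sum.elim (fun _ => -g0) (Sum.elim α 0)) (by
          ext p
          rw [quadricMatrix_mulVec]
          have e1 : ∑ i, v (e p) 0 * v (e p) (c i) * α i = v (e p) 0 * (v (e p) 0 * g0) := by
            rw [← hc1, Finset.mul_sum]
            exact Finset.sum_congr rfl fun i _ => by ring
          simp only [Sum.elim_inl, Sum.elim_inr, Pi.zero_apply, mul_zero, Finset.sum_const_zero,
            e1]
          ring)
      ext i
      exact congrFun this (Sum.inr (Sum.inl i))
    · have := Matrix.eq_zero_of_mulVec_of_isUnit hM
        (g := Sum.elim (fun _ => -a0) (Sum.elim (-a) β)) (by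
          ext p
          rw [quadricMatrix_mulVec]
          have e1 : ∑ i, v (e p) 0 * v (e p) (c i) * -a i =
              -(v (e p) 0 * ∑ i, a i * v (e p) (c i)) := by
            rw [Finset.mul_sum, ← Finset.sum_neg_distrib]
            exact Finset.sum_congr rfl fun i _ => by ring
          have e2 := hc2 (e p)
          simp only [mul_comm (β _)] at e2
          simp only [Sum.elim_inl, Sum.elim_inr, Pi.zero_apply, Pi.neg_apply, e1, e2]
          ring)
      ext i
      exact congrFun this (Sum.inr (Sum.inr i))

end CoordRing

/-! ### Specialisation to a bipartite configuration -/

/-- Algebraically independent elements specialise to arbitrary elements of the base field, along a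
local ring that maps to the big field. -/
theorem AlgebraicIndependent.exists_local_specialization {ι : Type u} {k : Type v}
    {K : Type w} [Field k] [Field K] [Algebra k K] {ξ : ι → K} (hξ : AlgebraicIndependent k ξ)
    (a : ι → k) :
    ∃ (O : Type (max u v)) (_ : CommRing O) (_ : IsLocalRing O) (f : O →+* K) (g : O →+* k)
      (y : ι → O),
      (∀ i, f (y i) = ξ i) ∧ (∀ i, g (y i) = a i) ∧ ∀ x, g x ≠ 0 → IsUnit x := by
  -- O is the polynomial ring localised at the kernel of evaluation at a. Evaluation at ξ also
  -- extends to O, since by independence it sends nonzero polynomials to nonzero elements.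
  let P := RingHom.ker (MvPolynomial.aeval (R := k) a).toRingHom
  have hP : P.IsPrime := RingHom.ker_isPrime _
  have hf : ∀ x : P.primeCompl, IsUnit ((MvPolynomial.aeval (R := k) ξ).toRingHom x) := by
    intro x
    rw [isUnit_iff_ne_zero]
    intro h
    have h1 : (x : MvPolynomial ι k) = 0 := hξ (by simpa using h)
    exact x.2 (by rw [h1]; exact P.zero_mem)
  have hg : ∀ x : P.primeCompl, IsUnit ((MvPolynomial.aeval (R := k) a).toRingHom x) := by
    intro x
    rw [isUnit_iff_ne_zero]
    exact x.2
  refine ⟨Localization.AtPrime P, inferInstance, inferInstance,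
    IsLocalization.lift (S := Localization.AtPrime P) hf,
    IsLocalization.lift (S := Localization.AtPrime P) hg,
    fun i => algebraMap (MvPolynomial ι k) (Localization.AtPrime P) (MvPolynomial.X i),
    fun i => ?_, fun i => ?_, fun x hx => ?_⟩
  · rw [IsLocalization.lift_eq]
    simp
  · rw [IsLocalization.lift_eq]
    simp
  · obtain ⟨p, s, rfl⟩ := IsLocalization.exists_mk'_eq P.primeCompl x
    rw [IsLocalization.AtPrime.isUnit_mk'_iff (Localization.AtPrime P) P]
    intro hp
    apply hx
    rw [IsLocalization.lift_mk', show (MvPolynomial.aeval (R := k) a).toRingHom p = 0 from hp,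
      zero_mul]

section Special

variable {r m : ℕ} (A B : Fin m → Fin r)

/-- The points `0`, `e_i` and `e_{A t} + e_{B t}` of affine space. -/
def specialPoint (k : Type*) [Zero k] [One k] : Unit ⊕ Fin r ⊕ Fin m → Fin r → k :=
  Sum.elim (fun _ => 0) (Sum.elim (fun i => Pi.single i 1) fun t j =>
    if j = A t ∨ j = B t then 1 else 0)

variable {A B} {k : Type*} [Field k] {n : ℕ} {c : Fin r → Fin (n + 1)}
  {a : Unit ⊕ Fin r ⊕ Fin m → Fin (n + 1) → k}

/-- The evaluation is triangular: the origin detects x_0², then e_i detects x_0 x_i, and e_{A t} +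
e_{B t} detects only its own edge product. -/
theorem isUnit_quadricMatrix_special (q : Fin r → Prop) (hA : ∀ t, ¬ q (A t)) (hB : ∀ t, q (B t))
    (hAB : Function.Injective fun t => (A t, B t)) (ha0 : ∀ p, a p 0 = 1)
    (ha : ∀ p i, a p (c i) = specialPoint A B k p i) : IsUnit (quadricMatrix c A B a) := by
  have hne : ∀ t t', A t ≠ B t' := fun t t' h => hA t (h ▸ hB t')
  refine Matrix.mulVec_injective_iff_isUnit.1
    ((injective_iff_map_eq_zero (quadricMatrix c A B a).mulVecLin).2 fun γ hγ => ?_)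
  have hrow : ∀ p, _ := fun p => (quadricMatrix_mulVec c A B a γ p).symm.trans (congrFun hγ p)
  simp only [ha0, ha, one_mul, Pi.zero_apply] at hrow
  have h1 : γ (Sum.inl ()) = 0 := by
    simpa [specialPoint] using hrow (Sum.inl ())
  have h2 : ∀ i, γ (Sum.inr (Sum.inl i)) = 0 := by
    intro i
    have := hrow (Sum.inr (Sum.inl i))
    have h3 : ∀ t, (Pi.single i 1 : Fin r → k) (A t) * (Pi.single i 1 : Fin r → k) (B t) = 0 := by
      intro t
      by_cases h : A t = i
      · rw [Pi.single_eq_of_ne (i := i) (i' := B t) (fun h' => hne t t (h.trans h'.symm)), mul_zero]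
      · rw [Pi.single_eq_of_ne h, zero_mul]
    simp only [specialPoint, Sum.elim_inl, Sum.elim_inr, h1, h3] at this
    simpa [Pi.single_apply] using this
  ext p
  rcases p with ⟨⟩ | i | t
  · exact h1
  · exact h2 i
  · have := hrow (Sum.inr (Sum.inr t))
    have h3 : ∀ t', (if A t' = A t ∨ A t' = B t then (1 : k) else 0) *
        (if B t' = A t ∨ B t' = B t then 1 else 0) = if t' = t then 1 else 0 := by
      intro t'
      have h4 : (A t' = A t ∧ B t' = B t) ↔ t' = t :=
        ⟨fun h => hAB (Prod.ext h.1 h.2), by rintro rfl; exact ⟨rfl, rfl⟩⟩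
      simp only [hne t' t, (hne t t').symm, or_false, false_or, ← h4]
      split_ifs <;> simp_all
    simpa [specialPoint, h1, h2, h3] using this

/-- Each special point has at most one nonzero coordinate in `q`, and it equals 1. Hence on these
points x_i x_j = 0 for i ≠ j, and x_i² = x_0 x_i; neither involves an edge product. -/
theorem quadricMatrix_special_mulVec (q : Fin r → Prop) (hA : ∀ t, ¬ q (A t))
    (ha0 : ∀ p, a p 0 = 1)
    (ha : ∀ p i, a p (c i) = specialPoint A B k p i) {i j : Fin r} (hi : q i) (hj : q j) :
    quadricMatrix c A B a *ᵥ (if i = j then Pi.single (Sum.inr (Sum.inl i)) 1 else 0) =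
      fun p => a p (c i) * a p (c j) := by
  have hiA : ∀ t, i ≠ A t := fun t h => hA t (h ▸ hi)
  have hjA : ∀ t, j ≠ A t := fun t h => hA t (h ▸ hj)
  ext p
  rw [quadricMatrix_mulVec]
  by_cases hij : i = j
  · subst hij
    simp only [ha0, ha, one_mul, if_pos]
    rcases p with ⟨⟩ | i' | t
    · simp [specialPoint]
    · simp [specialPoint, Pi.single_apply]
    · simp [specialPoint, Pi.single_apply]
  · simp only [ha0, ha, one_mul, if_neg hij]
    rcases p with ⟨⟩ | i' | t
    · simp [specialPoint]
    · simp only [specialPoint, Pi.single_apply, Sum.elim_inl, Sum.elim_inr, Pi.zero_apply, mul_zero,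
        Finset.sum_const_zero, add_zero]
      split_ifs with h1 h2
      · exact absurd (h1.trans h2.symm) hij
      all_goals simp
    · simp only [specialPoint, Sum.elim_inr, Pi.zero_apply, mul_zero,
        Finset.sum_const_zero, add_zero, hiA, hjA, false_or]
      split_ifs with h1 h2
      · exact absurd (h1.trans h2.symm) hij
      all_goals simp

end Special

theorem quadricMatrix_map {O S : Type*} [CommRing O] [CommRing S] (φ : O →+* S) {n r m : ℕ}
    (c : Fin r → Fin (n + 1)) (A B : Fin m → Fin r)
    (y : Unit ⊕ Fin r ⊕ Fin m → Fin (n + 1) → O) :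
    (quadricMatrix c A B y).map φ = quadricMatrix c A B fun p j => φ (y p j) := by
  ext p (⟨⟩ | i | t) <;> simp [quadricMatrix]

/-- Over O the interpolation determinant is a unit, since it specialises to a nonzero element, so
the structure constants exist over O. Those for products within `q` specialise to 0, hence are
nonunits. The strand built over O is then mapped to K. -/
theorem CoordRing.isKoszul_of_isGenericPoints {k K : Type*} [Field k] [Field K] [Algebra k K]
    {n : ℕ} {X : Set (Projectivization K (Fin (n + 1) → K))} (hX : IsGenericPoints k X) {r m : ℕ}
    (e : Unit ⊕ Fin r ⊕ Fin m ≃ X) (c : Fin r → Fin (n + 1)) (hc : Function.Injective c)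
    (hc0 : ∀ i, c i ≠ 0) (hcov : ∀ j, j = 0 ∨ j ∈ Set.range c ∨ m = 0) (A B : Fin m → Fin r)
    (q : Fin r → Prop) (hA : ∀ t, ¬ q (A t)) (hB : ∀ t, q (B t))
    (hAB : Function.Injective fun t => (A t, B t)) : IsKoszul (grading X) := by
  classical
  obtain ⟨v, hv, hind⟩ := hX
  have hv0 : ∀ p, v p 0 ≠ 0 := fun p => hind.ne_zero (p, 0)
  -- The default value 1 sets x_0 = 1; on other coordinates outside the range of `c` it is
  -- immaterial.
  let a : Unit ⊕ Fin r ⊕ Fin m → Fin (n + 1) → k := fun p =>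
    Function.extend c (specialPoint A B k p) 1
  have ha0 : ∀ p, a p 0 = 1 := fun p =>
    Function.extend_apply' _ _ _ fun ⟨i, hi⟩ => hc0 i hi
  have ha : ∀ p i, a p (c i) = specialPoint A B k p i := fun p i => hc.extend_apply _ _ _
  obtain ⟨O, _, _, f, g, y, hf, hg, hunit⟩ :=
    hind.exists_local_specialization fun z => a (e.symm z.1) z.2
  let Y : Unit ⊕ Fin r ⊕ Fin m → Fin (n + 1) → O := fun p j => y (e p, j)
  have hYf : ∀ p j, f (Y p j) = v (e p) j := fun p j => hf (e p, j)
  have hYg : ∀ p j, g (Y p j) = a p j := fun p j => by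
    simp only [Y, hg, Equiv.symm_apply_apply]
  have hM : IsUnit (quadricMatrix c A B Y) := by
    rw [Matrix.isUnit_iff_isUnit_det]
    refine hunit _ ?_
    rw [RingHom.map_det, RingHom.mapMatrix_apply, quadricMatrix_map g, funext₂ hYg,
      ← isUnit_iff_ne_zero, ← Matrix.isUnit_iff_isUnit_det]
    exact isUnit_quadricMatrix_special q hA hB hAB ha0 ha
  choose γ hγ using fun i j => Matrix.exists_mulVec_eq_of_isUnit hM
    fun p => Y p (c i) * Y p (c j)
  obtain ⟨L⟩ := nonempty_linearStrand (fun i j t => γ i j (Sum.inr (Sum.inr t))) q A B hB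
    (fun t k => by
      have h1 : γ (B t) (A t) - Pi.single (Sum.inr (Sum.inr t)) 1 = 0 := by
        refine Matrix.eq_zero_of_mulVec_of_isUnit hM ?_
        rw [Matrix.mulVec_sub, hγ, Matrix.mulVec_single_one]
        ext p
        simp [quadricMatrix, mul_comm]
      have h2 := congrFun (sub_eq_zero.1 h1) (Sum.inr (Sum.inr k))
      simpa [Pi.single_apply] using h2)
    (fun i j t hi hj => by
      have h1 := congrArg (g ∘ ·) (hγ i j)
      have h2 : g ∘ γ i j - (if i = j then Pi.single (Sum.inr (Sum.inl i)) 1 else 0) = 0 := by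
        refine Matrix.eq_zero_of_mulVec_of_isUnit
          (isUnit_quadricMatrix_special q hA hB hAB ha0 ha) ?_
        rw [Matrix.mulVec_sub, quadricMatrix_special_mulVec q hA ha0 ha hi hj, sub_eq_zero]
        ext p
        have h3 := congrFun h1 p
        simp only [Function.comp_apply, RingHom.map_mulVec, quadricMatrix_map, map_mul, hYg] at h3
        exact h3
      have h3 := congrFun (sub_eq_zero.1 h2) (Sum.inr (Sum.inr t))
      have h4 : g (γ i j (Sum.inr (Sum.inr t))) = 0 := by
        refine Eq.trans h3 ?_
        split_ifs <;> simp
      rw [IsLocalRing.mem_maximalIdeal, mem_nonunits_iff]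
      intro h5
      exact (h5.map g).ne_zero h4)
  have hfM : quadricMatrix c A B (fun p => v (e p)) = (quadricMatrix c A B Y).map f := by
    rw [quadricMatrix_map, funext₂ hYf]
  refine isKoszul_of_linearStrand hv e c A B hcov ?_ hv0 (L.map f) fun i j =>
    ⟨f ∘ γ i j, fun t => rfl, ?_⟩
  · rw [hfM]
    exact hM.map f.mapMatrix
  · ext p
    have h1 := congrArg f (congrFun (hγ i j) p)
    simp only [RingHom.map_mulVec, map_mul, hYf] at h1
    rw [hfM]
    exact h1

/-- Two parts as equal as possible span ⌊r²/4⌋ edges. -/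
theorem exists_bipartite_edges {r m : ℕ} (h : 4 * m ≤ r ^ 2) :
    ∃ (A B : Fin m → Fin r) (q : Fin r → Prop), (∀ t, ¬ q (A t)) ∧ (∀ t, q (B t)) ∧
      Function.Injective fun t => (A t, B t) := by
  obtain ⟨a, b, hab, hm⟩ : ∃ a b, a + b = r ∧ m ≤ a * b := by
    obtain ⟨a, rfl | rfl⟩ := Nat.even_or_odd' r
    · exact ⟨a, a, by ring, by nlinarith⟩
    · refine ⟨a, a + 1, by ring, ?_⟩
      have : (2 * a + 1) ^ 2 = 4 * (a * (a + 1)) + 1 := by ring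
      omega
  subst hab
  obtain ⟨φ⟩ := Function.Embedding.nonempty_of_card_le
    (show Fintype.card (Fin m) ≤ Fintype.card (Fin a × Fin b) by simpa using hm)
  refine ⟨fun t => Fin.castAdd b (φ t).1, fun t => Fin.natAdd a (φ t).2, fun i => a ≤ i,
    fun t => by simp, fun t => by simp, fun t t' htt => φ.injective ?_⟩
  simp only [Prod.mk.injEq, Fin.castAdd_inj, Fin.natAdd_inj] at htt
  exact Prod.ext htt.1 htt.2

theorem CoordRing.isKoszul_of_ncard_le {k K : Type*} [Field k] [Field K] [Algebra k K]
    {n : ℕ} {X : Set (Projectivization K (Fin (n + 1) → K))} (hX : IsGenericPoints k X)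
    (hfin : X.Finite) (hne : X.Nonempty) (hcard : 4 * X.ncard ≤ 4 + 4 * n + n ^ 2) :
    IsKoszul (grading X) := by
  have hpos : 0 < X.ncard := (Set.ncard_pos hfin).2 hne
  have := hfin.fintype
  obtain ⟨r, m, hrm, hrn, hor, hm⟩ : ∃ r m, 1 + r + m = X.ncard ∧ r ≤ n ∧ (r = n ∨ m = 0) ∧
      4 * m ≤ r ^ 2 := by
    -- With at most n + 1 points, |X| - 1 variables besides x_0 suffice and no edges are needed.
    rcases le_total (n + 1) X.ncard with h | h
    · exact ⟨n, X.ncard - (n + 1), by omega, le_rfl, Or.inl rfl, by omega⟩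
    · exact ⟨X.ncard - 1, 0, by omega, by omega, Or.inr rfl, by simp⟩
  obtain ⟨A, B, q, hA, hB, hAB⟩ := exists_bipartite_edges hm
  have hc : Fintype.card (Unit ⊕ Fin r ⊕ Fin m) = Fintype.card X := by
    rw [← Nat.card_eq_fintype_card (α := X), Nat.card_coe_set_eq, ← hrm]
    simp
    ring
  refine isKoszul_of_isGenericPoints hX (Fintype.equivOfCardEq hc)
    (fun i => (Fin.castLE hrn i).succ) (fun i j hij => by simpa using hij)
    (fun i => Fin.succ_ne_zero _) (fun j => ?_) A B q hA hB hAB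
  rcases hor with rfl | h
  · refine (Fin.eq_zero_or_eq_succ j).imp_right ?_
    rintro ⟨i, rfl⟩
    exact Or.inl ⟨i, rfl⟩
  · exact Or.inr (Or.inr h)

/-! ### Degreewise lifting in a linear resolution -/

namespace MinimalResolution

variable {K : Type*} [Field K] {n : ℕ} {X : Set (Projectivization K (Fin (n + 1) → K))}
  {v : X → Fin (n + 1) → K} (F : MinimalResolution (CoordRing.grading X))

open CoordRing

theorem mem_shiftedPiece_iff (hdeg : ∀ i a, F.deg i a = i) {i d : ℕ}
    {u : Fin (F.betti i) → CoordRing X} :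
    u ∈ shiftedPiece (grading X) (F.deg i) (i + d) ↔ ∀ a, u a ∈ grading X d := by
  simp only [shiftedPiece, hdeg, Set.mem_ofPred_eq, Nat.le_add_right, Nat.add_sub_cancel_left,
    true_implies, Nat.not_lt.2 (Nat.le_add_right i d), false_implies, and_true]

theorem d_mem (hdeg : ∀ i a, F.deg i a = i) {i d : ℕ} {u : Fin (F.betti (i + 1)) → CoordRing X}
    (hu : ∀ a, u a ∈ grading X d) (c) : F.d i u c ∈ grading X (d + 1) := by
  have h1 := F.d_homogeneous i (i + 1 + d) u ((F.mem_shiftedPiece_iff hdeg).2 hu)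
  rw [show i + 1 + d = i + (d + 1) by ring, F.mem_shiftedPiece_iff hdeg] at h1
  exact h1 c

theorem d_single_mem (hdeg : ∀ i a, F.deg i a = i) (i a c) :
    F.d i (Pi.single a 1) c ∈ grading X 1 := by
  classical
  refine F.d_mem hdeg (d := 0) (fun b => ?_) c
  rw [Pi.single_apply]
  split_ifs
  · exact mem_grading_zero_iff.2 ⟨1, map_one _⟩
  · exact zero_mem _

theorem d_apply (i : ℕ) (u : Fin (F.betti (i + 1)) → CoordRing X) (c) :
    F.d i u c = ∑ a, u a * F.d i (Pi.single a 1) c := by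
  rw [LinearMap.pi_apply_eq_sum_univ (F.d i) u]
  simp only [Finset.sum_apply, Pi.smul_apply, smul_eq_mul]
  refine Finset.sum_congr rfl fun a _ => ?_
  rw [show (Pi.single a 1 : Fin (F.betti (i + 1)) → CoordRing X) = fun b => if a = b then 1 else 0
    from funext fun b => by simp [Pi.single_apply, eq_comm]]

theorem d_comp (hv : IsCoords v) (hdeg : ∀ i a, F.deg i a = i) (i d : ℕ)
    (u : Fin (F.betti (i + 1)) → CoordRing X) (c) :
    F.d i (fun a => comp X d (u a)) c = comp X (d + 1) (F.d i u c) := by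
  rw [F.d_apply, F.d_apply, comp_sum hv]
  exact Finset.sum_congr rfl fun a _ => (comp_mul_of_mem hv (F.d_single_mem hdeg i a c) _).symm

/-- The differentials have linear entries, so they commute with taking components, up to a shift by
one; any lift can be replaced by its component of the right degree. -/
theorem exists_lift (hv : IsCoords v) (hdeg : ∀ i a, F.deg i a = i) {i d : ℕ}
    {u : Fin (F.betti i) → CoordRing X} (hu : ∀ a, u a ∈ grading X (d + 1))
    (h : ∃ w, F.d i w = u) : ∃ w, (∀ a, w a ∈ grading X d) ∧ F.d i w = u := by
  obtain ⟨w, rfl⟩ := h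
  refine ⟨fun a => comp X d (w a), fun a => comp_mem _ _, ?_⟩
  ext c
  rw [F.d_comp hv hdeg, comp_of_mem hv (hu c)]

theorem exists_lift_of_d_eq_zero (hv : IsCoords v) (hdeg : ∀ i a, F.deg i a = i) {i d : ℕ}
    {u : Fin (F.betti (i + 1)) → CoordRing X} (hu : ∀ a, u a ∈ grading X (d + 1))
    (h : F.d i u = 0) : ∃ w, (∀ a, w a ∈ grading X d) ∧ F.d (i + 1) w = u :=
  F.exists_lift hv hdeg hu ((F.exact i u).1 h)

theorem exists_lift_zero (hv : IsCoords v) (hdeg : ∀ i a, F.deg i a = i) {d : ℕ}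
    {u : Fin (F.betti 0) → CoordRing X} (hu : ∀ a, u a ∈ grading X (d + 1)) :
    ∃ w, (∀ a, w a ∈ grading X d) ∧ F.d 0 w = u := by
  refine F.exists_lift hv hdeg hu ((F.exact_aug u).1 (F.aug_homogeneous (d + 1) (by simp) u ?_))
  have := (F.mem_shiftedPiece_iff hdeg (i := 0) (d := d + 1) (u := u)).2 hu
  rwa [zero_add] at this

end MinimalResolution

/-! ### Koszulness forces equations of degree two -/

namespace CoordRing

variable {K : Type*} [Field K] {n : ℕ} {X : Set (Projectivization K (Fin (n + 1) → K))}
  {v : X → Fin (n + 1) → K}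

theorem eq_zero_of_mem_irrelevantIdeal (hv : IsCoords v) {r : CoordRing X}
    (hr : r ∈ irrelevantIdeal (grading X)) (h0 : r ∈ grading X 0) : r = 0 := by
  refine ext_evalAt hv fun p => ?_
  have hle : irrelevantIdeal (grading X) ≤
      RingHom.ker ((Polynomial.constantCoeff (R := K)).comp (evalAt hv p).toRingHom) := by
    refine Ideal.span_le.2 ?_
    rintro y ⟨i, hi, hy⟩
    change (evalAt hv p y).coeff 0 = 0
    rw [evalAt_of_mem hv hy, Polynomial.coeff_monomial, if_neg hi.ne']
  have h1 : (evalAt hv p r).coeff 0 = 0 := hle hr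
  rw [evalAt_of_mem hv h0, h1]
  simp

theorem betti_zero_pos (hv : IsCoords v) (hne : X.Nonempty)
    (F : MinimalResolution (grading X)) : 0 < F.betti 0 := by
  obtain ⟨p, hp⟩ := hne
  rw [Nat.pos_iff_ne_zero]
  intro h
  have : IsEmpty (Fin (F.betti 0)) := by rw [h]; infer_instance
  obtain ⟨u, hu⟩ := F.aug_surjective (Ideal.Quotient.mk _ 1)
  rw [Subsingleton.elim u 0, map_zero] at hu
  have h1 := eq_zero_of_mem_irrelevantIdeal hv (Ideal.Quotient.eq_zero_iff_mem.1 hu.symm)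
    (mem_grading_zero_iff.2 ⟨1, map_one _⟩)
  have h2 := congrArg (evalAt hv ⟨p, hp⟩) h1
  rw [map_one, map_zero] at h2
  exact one_ne_zero h2

theorem exists_eq_sum_X_mul {d : ℕ} {f : MvPolynomial (Fin (n + 1)) K}
    (hf : f.IsHomogeneous (d + 1)) : ∃ g : Fin (n + 1) → MvPolynomial (Fin (n + 1)) K,
      (∀ j, (g j).IsHomogeneous d) ∧ f = ∑ j, MvPolynomial.X j * g j := by
  have h1 : f ∈ MvPolynomial.homogeneousSubmodule (Fin (n + 1)) K 1 *
      MvPolynomial.homogeneousSubmodule (Fin (n + 1)) K d := by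
    rw [← MvPolynomial.homogeneousSubmodule_one_pow (σ := Fin (n + 1)) (R := K) d, ← pow_succ',
      MvPolynomial.homogeneousSubmodule_one_pow]
    exact hf
  induction h1 using Submodule.mul_induction_on' with
  | mem_mul_mem a ha b hb =>
    rw [MvPolynomial.homogeneousSubmodule_one_eq_span_X,
      Submodule.mem_span_range_iff_exists_fun] at ha
    obtain ⟨γ, rfl⟩ := ha
    refine ⟨fun j => γ j • b, fun j => Submodule.smul_mem _ (γ j) hb, ?_⟩
    simp [Finset.sum_mul]
  | add a ha b hb iha ihb =>
    have hle := MvPolynomial.homogeneousSubmodule_mul (σ := Fin (n + 1)) (R := K) 1 d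
    rw [add_comm 1 d] at hle
    obtain ⟨g, hg, hga⟩ := iha (hle ha)
    obtain ⟨g', hg', hgb⟩ := ihb (hle hb)
    refine ⟨fun j => g j + g' j, fun j => (hg j).add (hg' j), ?_⟩
    rw [hga, hgb, ← Finset.sum_add_distrib]
    simp only [mul_add]

/-- If the coordinate ring is Koszul and no quadric contains `X`, then no hypersurface does. -/
theorem eq_zero_of_mk_eq_zero (hv : IsCoords v) (hne : X.Nonempty)
    (F : MinimalResolution (grading X)) (hdeg : ∀ i a, F.deg i a = i)
    (h2 : ∀ f : MvPolynomial (Fin (n + 1)) K, f.IsHomogeneous 2 → mk X f = 0 → f = 0)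
    (d : ℕ) (f : MvPolynomial (Fin (n + 1)) K) (hf : f.IsHomogeneous d) (hf0 : mk X f = 0) :
    f = 0 := by
  induction d using Nat.strong_induction_on generalizing f with
  | _ d ih =>
  obtain hd | ⟨d, rfl⟩ : d ≤ 2 ∨ ∃ d', d = d' + 3 := by
    rcases le_or_gt d 2 with h | h
    · exact Or.inl h
    · exact Or.inr ⟨d - 3, by omega⟩
  -- A form of degree at most 2 is raised to degree 2 by a power of x_0.
  · have h3 := h2 (MvPolynomial.X 0 ^ (2 - d) * f) (by
      have := (MvPolynomial.isHomogeneous_X_pow (R := K) (0 : Fin (n + 1)) (2 - d)).mul hf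
      rwa [Nat.sub_add_cancel hd] at this) (by rw [map_mul, hf0, mul_zero])
    rw [mul_eq_zero, or_iff_right (pow_ne_zero _ (MvPolynomial.X_ne_zero _))] at h3
    exact h3
  have ih' : ∀ e, e < d + 3 → ∀ f g : MvPolynomial (Fin (n + 1)) K, f.IsHomogeneous e →
      g.IsHomogeneous e → mk X f = mk X g → f = g := fun e he f g hf hg hfg =>
    sub_eq_zero.1 (ih e he (f - g) (hf.sub hg) (by rw [map_sub, hfg, sub_self]))
  -- The relation ∑ x_j g_j = 0 in R(X) gives a cycle in F_1, hence a boundary from F_2 with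
  -- coefficients z. The resulting identities have degrees 1, 2 and d + 2, all below d + 3, so by
  -- induction they hold between polynomials; substituting them gives f = ∑ z Q ρ = 0.
  obtain ⟨g, hg, hfg⟩ := exists_eq_sum_X_mul (d := d + 2) hf
  let a0 : Fin (F.betti 0) := ⟨0, betti_zero_pos hv hne F⟩
  have hy : ∀ j, ∃ w, (∀ a, w a ∈ grading X 0) ∧ F.d 0 w = Pi.single a0 (var X j) := fun j =>
    F.exists_lift_zero hv hdeg (d := 0) fun a => by
      rw [Pi.single_apply]
      split_ifs
      · exact var_mem j
      · exact zero_mem _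
  choose Y hY0 hY using hy
  choose y hyh hy using fun j c => mem_grading_iff.1 (hY0 j c)
  choose ρ hρh hρ using fun c => mem_grading_iff.1 (F.d_single_mem hdeg 0 c a0)
  choose Q hQh hQ using fun a c => mem_grading_iff.1 (F.d_single_mem hdeg 1 a c)
  let u : Fin (F.betti 1) → CoordRing X := ∑ j, mk X (g j) • Y j
  have hu : ∀ c, u c = ∑ j, mk X (g j) * Y j c := fun c => by simp [u]
  have hu0 : F.d 0 u = 0 := by
    simp only [u, map_sum, map_smul, hY]
    have : ∑ j, mk X (g j) • (Pi.single a0 (var X j) : Fin (F.betti 0) → CoordRing X) =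
        Pi.single a0 (mk X f) := by
      rw [hfg, map_sum]
      ext c
      by_cases hc : c = a0
      · subst hc
        simp [var, mul_comm]
      · simp [hc]
    rw [this, hf0, Pi.single_zero]
  obtain ⟨w, hw, hwu⟩ := F.exists_lift_of_d_eq_zero hv hdeg (i := 0) (d := d + 1) (u := u)
    (fun c => by
      rw [hu]
      exact Submodule.sum_mem _ fun j _ =>
        mul_mem_grading (d := d + 2) (e := 0) (mem_grading_iff.2 ⟨g j, hg j, rfl⟩) (hY0 j c)) hu0
  choose z hzh hz using fun a => mem_grading_iff.1 (hw a)
  have e1 : ∀ j, ∑ c, y j c * ρ c = MvPolynomial.X j := by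
    intro j
    refine ih' 1 (by omega) _ _ (MvPolynomial.IsHomogeneous.sum _ _ _ fun c _ => ?_)
      (MvPolynomial.isHomogeneous_X _ _) ?_
    · simpa using (hyh j c).mul (hρh c)
    · have := congrFun (hY j) a0
      rw [F.d_apply, Pi.single_eq_same] at this
      rw [map_sum]
      refine Eq.trans (Finset.sum_congr rfl fun c _ => ?_) this
      rw [map_mul, hy, hρ]
  have e2 : ∀ a, ∑ c, Q a c * ρ c = 0 := by
    intro a
    refine ih' 2 (by omega) _ _ (MvPolynomial.IsHomogeneous.sum _ _ _ fun c _ => ?_)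
      (MvPolynomial.isHomogeneous_zero _ _ _) ?_
    · simpa using (hQh a c).mul (hρh c)
    · have := congrFun ((F.exact 0 (F.d 1 (Pi.single a 1))).2 ⟨_, rfl⟩) a0
      rw [F.d_apply] at this
      rw [map_sum, map_zero]
      refine Eq.trans (Finset.sum_congr rfl fun c _ => ?_) this
      rw [map_mul, hQ, hρ]
  have e3 : ∀ c, ∑ j, g j * y j c = ∑ a, z a * Q a c := by
    intro c
    refine ih' (d + 2) (by omega) _ _ (MvPolynomial.IsHomogeneous.sum _ _ _ fun j _ => ?_)
      (MvPolynomial.IsHomogeneous.sum _ _ _ fun a _ => ?_) ?_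
    · simpa using (hg j).mul (hyh j c)
    · simpa using (hzh a).mul (hQh a c)
    · have := congrFun hwu c
      rw [F.d_apply, hu] at this
      rw [map_sum, map_sum]
      simpa only [map_mul, hy, hz, hQ] using this.symm
  calc f = ∑ j, (∑ c, y j c * ρ c) * g j := by simp only [e1, ← hfg]
    _ = ∑ c, ρ c * ∑ j, g j * y j c := by
      simp only [Finset.sum_mul, Finset.mul_sum]
      rw [Finset.sum_comm]
      exact Finset.sum_congr rfl fun c _ => Finset.sum_congr rfl fun j _ => by ring
    _ = ∑ a, z a * ∑ c, Q a c * ρ c := by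
      simp only [e3, Finset.mul_sum]
      rw [Finset.sum_comm]
      exact Finset.sum_congr rfl fun c _ => Finset.sum_congr rfl fun j _ => by ring
    _ = 0 := by simp [e2]

theorem not_isKoszul_of_no_quadric (hv : IsCoords v) (hfin : X.Finite) (hne : X.Nonempty)
    (hn : n ≠ 0) (hv0 : ∀ p, v p 0 ≠ 0)
    (h2 : ∀ f : MvPolynomial (Fin (n + 1)) K, f.IsHomogeneous 2 → mk X f = 0 → f = 0) :
    ¬ IsKoszul (grading X) := by
  rintro ⟨F, hdeg⟩
  have := hfin.fintype
  let i1 : Fin (n + 1) := ⟨1, by omega⟩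
  have hi1 : i1 ≠ 0 := by simp [i1, Fin.ext_iff]
  -- `lam p` is a nonzero linear form through p, so the product over X is a nonzero form vanishing
  -- on X.
  let lam : X → MvPolynomial (Fin (n + 1)) K := fun p =>
    MvPolynomial.C (v p i1) * MvPolynomial.X 0 - MvPolynomial.C (v p 0) * MvPolynomial.X i1
  have hlam : ∀ p, (lam p).IsHomogeneous 1 := fun p =>
    (MvPolynomial.isHomogeneous_C_mul_X _ _).sub (MvPolynomial.isHomogeneous_C_mul_X _ _)
  have hlam0 : ∀ p, lam p ≠ 0 := fun p h => by
    have := congrArg (MvPolynomial.eval (Pi.single i1 1)) h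
    simp [lam, hi1.symm, hv0 p] at this
  refine Finset.prod_ne_zero_iff.2 (fun p (_ : p ∈ Finset.univ) => hlam0 p)
    (eq_zero_of_mk_eq_zero hv hne F hdeg h2 _ _
      (MvPolynomial.IsHomogeneous.prod Finset.univ lam (fun _ => 1) fun p _ => hlam p) ?_)
  refine ext_evalAt hv fun p => ?_
  rw [map_prod, map_prod, map_zero]
  refine Finset.prod_eq_zero (Finset.mem_univ p) ?_
  rw [evalAt_mk, evalLine_of_isHomogeneous _ (hlam p)]
  simp [lam, mul_comm]

end CoordRing

/-! ### Recurrence of the Betti numbers -/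

/-- A linear recurrence of order two with non-real characteristic roots has no solution in
natural numbers, apart from zero. -/
theorem not_linear_recurrence {b : ℕ → ℕ} {n e : ℕ} (h : n ^ 2 < 4 * e) (hb : 0 < b 0)
    (hrec : ∀ j, (b (j + 2) : ℤ) = n * b (j + 1) - e * b j) : False := by
  have he : (0 : ℤ) < e := by
    have : 0 < e := by by_contra! h'; simp [Nat.le_zero.1 h'] at h
    exact_mod_cast this
  -- A zero following a positive term would make the next term negative.
  have hpos : ∀ j, 0 < b j := by
    intro j
    induction j with
    | zero => exact hb
    | succ j ih =>
      by_contra! h0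
      have h1 := hrec j
      rw [Nat.le_zero.1 h0] at h1
      have : (0 : ℤ) < b j := by exact_mod_cast ih
      have := mul_pos he this
      simp at h1
      omega
  have hposR : ∀ j, (0 : ℝ) < b j := fun j => by exact_mod_cast hpos j
  have heR : (0 : ℝ) < e := by exact_mod_cast he
  have hrecR : ∀ j, (b (j + 2) : ℝ) = n * b (j + 1) - e * b j := fun j => by
    exact_mod_cast hrec j
  have hn : (0 : ℝ) < n := by
    have h1 := hposR 2
    rw [hrecR 0] at h1
    have h2 := mul_pos heR (hposR 0)
    by_contra! h3
    nlinarith [hposR 1]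
  have hd : (0 : ℝ) < 4 * e - n ^ 2 := by
    have : (n : ℝ) ^ 2 < 4 * e := by exact_mod_cast h
    linarith
  -- A ratio x of consecutive terms is followed by n - e/x. The drop is (x² - n x + e)/x ≥ (4e -
  -- n²)/(4x) ≥ δ, using x ≤ n; the positive ratios would eventually become negative.
  set δ : ℝ := (4 * e - n ^ 2) / (4 * n) with hδ
  have hδ0 : 0 < δ := by positivity
  have hle : ∀ j, (b (j + 2) : ℝ) / b (j + 1) ≤ n := fun j => by
    rw [div_le_iff₀ (hposR _), hrecR]
    nlinarith [mul_pos heR (hposR j)]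
  have hstep : ∀ j, (b (j + 3) : ℝ) / b (j + 2) ≤ b (j + 2) / b (j + 1) - δ := fun j => by
    have hx := hle j
    set x : ℝ := (b (j + 2) : ℝ) / b (j + 1) with hxdef
    have hx0 : 0 < x := div_pos (hposR _) (hposR _)
    have h1 : (b (j + 3) : ℝ) / b (j + 2) = n - e / x := by
      rw [hrecR (j + 1), hxdef]
      have := (hposR (j + 1)).ne'
      have := (hposR (j + 2)).ne'
      field_simp
    have h2 : δ * x ≤ (4 * e - n ^ 2) / 4 := by
      calc δ * x ≤ δ * n := by gcongr
        _ = _ := by rw [hδ]; field_simp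
    rw [h1, ← sub_nonneg]
    have h3 : x - δ - (n - e / x) = (x ^ 2 - n * x + e - δ * x) / x := by
      field_simp
      ring
    rw [h3]
    refine div_nonneg ?_ hx0.le
    nlinarith [sq_nonneg (x - n / 2)]
  have hbound : ∀ j : ℕ, (b (j + 2) : ℝ) / b (j + 1) ≤ n - j * δ := by
    intro j
    induction j with
    | zero => simpa using hle 0
    | succ j ih =>
      refine (hstep j).trans ?_
      push_cast
      linarith
  obtain ⟨N, hN⟩ := exists_nat_gt ((n : ℝ) / δ)
  have h1 := hbound N
  have h2 : 0 < (b (N + 2) : ℝ) / b (N + 1) := div_pos (hposR _) (hposR _)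
  rw [div_lt_iff₀ hδ0] at hN
  linarith

namespace CoordRing

variable {K : Type*} [Field K] {n : ℕ} {X : Set (Projectivization K (Fin (n + 1) → K))}
  {v : X → Fin (n + 1) → K}

instance finite_grading (d : ℕ) : Module.Finite K (grading X d) :=
  Module.Finite.iff_fg.2 ((MvPolynomial.homogeneousSubmodule_fg (Fin (n + 1)) K d).map _)

/-- The values of a form at the points of `X`. -/
noncomputable def values (hv : IsCoords v) (d : ℕ) : grading X d →ₗ[K] (X → K) :=
  LinearMap.pi fun p => Polynomial.lcoeff K d ∘ₗ (evalAt hv p).toLinearMap ∘ₗ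
    (grading X d).subtype

theorem values_apply (hv : IsCoords v) (d : ℕ) (r : grading X d) (p : X) :
    values hv d r p = (evalAt hv p r).coeff d := rfl

theorem values_injective (hv : IsCoords v) (d : ℕ) : Function.Injective (values hv d) := by
  rw [injective_iff_map_eq_zero]
  intro r hr
  refine Subtype.ext (ext_evalAt hv fun p => ?_)
  rw [evalAt_of_mem hv r.2, ← values_apply, hr]
  simp

/-- Multiplication by a variable. -/
noncomputable def mulVar (X : Set (Projectivization K (Fin (n + 1) → K))) (j : Fin (n + 1))
    (d : ℕ) : grading X d →ₗ[K] grading X (d + 1) :=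
  LinearMap.codRestrict _ (LinearMap.mulRight K (var X j) ∘ₗ (grading X d).subtype)
    fun r => mul_mem_grading r.2 (var_mem j)

theorem mulVar_apply (j : Fin (n + 1)) (d : ℕ) (r : grading X d) :
    (mulVar X j d r : CoordRing X) = r * var X j := rfl

theorem mulVar_injective (hv : IsCoords v) (hv0 : ∀ p, v p 0 ≠ 0) (d : ℕ) :
    Function.Injective (mulVar X 0 d) := by
  rw [injective_iff_map_eq_zero]
  intro r hr
  refine Subtype.ext (mul_left_cancel_of_ne_zero hv (l := var X 0) (fun p => ?_) ?_)
  · simpa using hv0 p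
  · rw [mul_comm, ← mulVar_apply, hr]
    rfl

end CoordRing

namespace MinimalResolution

variable {K : Type*} [Field K] {n : ℕ} {X : Set (Projectivization K (Fin (n + 1) → K))}
  {v : X → Fin (n + 1) → K} (F : MinimalResolution (CoordRing.grading X))

open CoordRing

/-- The differential of a linear resolution on vectors with entries of degree `d`. -/
noncomputable def strand (hdeg : ∀ i a, F.deg i a = i) (i d : ℕ) :
    (Fin (F.betti (i + 1)) → grading X d) →ₗ[K] (Fin (F.betti i) → grading X (d + 1)) where
  toFun u c := ⟨F.d i (fun a => u a) c, F.d_mem hdeg (fun a => (u a).2) c⟩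
  map_add' u w := by
    ext c
    exact congrFun ((F.d i).map_add (fun a => (u a : CoordRing X)) fun a => (w a : CoordRing X)) c
  map_smul' k u := by
    ext c
    exact congrFun ((F.d i).map_smul_of_tower k fun a => (u a : CoordRing X)) c

theorem ker_strand (hv : IsCoords v) (hdeg : ∀ i a, F.deg i a = i) (i d : ℕ) :
    LinearMap.ker (F.strand hdeg i (d + 1)) = LinearMap.range (F.strand hdeg (i + 1) d) := by
  ext u
  rw [LinearMap.mem_ker, LinearMap.mem_range]
  constructor
  · intro hu
    obtain ⟨w, hw, hwu⟩ := F.exists_lift_of_d_eq_zero hv hdeg (fun a => (u a).2)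
      (funext fun c => congrArg Subtype.val (congrFun hu c))
    exact ⟨fun a => ⟨w a, hw a⟩, funext fun c => Subtype.ext (congrFun hwu c)⟩
  · rintro ⟨w, rfl⟩
    exact funext fun c => Subtype.ext (congrFun ((F.exact i _).2 ⟨fun a => w a, rfl⟩) c)

theorem strand_zero_surjective (hv : IsCoords v) (hdeg : ∀ i a, F.deg i a = i) (d : ℕ) :
    LinearMap.range (F.strand hdeg 0 d) = ⊤ := by
  refine LinearMap.range_eq_top.2 fun u => ?_
  obtain ⟨w, hw, hwu⟩ := F.exists_lift_zero hv hdeg (fun a => (u a).2)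
  exact ⟨fun a => ⟨w a, hw a⟩, funext fun c => Subtype.ext (congrFun hwu c)⟩

/-- By minimality boundaries have entries in the irrelevant ideal, which meets degree zero only in
0. -/
theorem ker_strand_zero (hv : IsCoords v) (hdeg : ∀ i a, F.deg i a = i) (i : ℕ) :
    LinearMap.ker (F.strand hdeg i 0) = ⊥ := by
  rw [LinearMap.ker_eq_bot']
  intro u hu
  obtain ⟨w, hw⟩ := (F.exact i fun a => (u a : CoordRing X)).1
    (funext fun c => congrArg Subtype.val (congrFun hu c))
  ext a
  refine eq_zero_of_mem_irrelevantIdeal hv ?_ (u a).2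
  rw [← congrFun hw a]
  exact F.minimal _ _ _

theorem finrank_strand (hdeg : ∀ i a, F.deg i a = i) (i d : ℕ) :
    Module.finrank K (LinearMap.range (F.strand hdeg i d)) +
      Module.finrank K (LinearMap.ker (F.strand hdeg i d)) =
      F.betti (i + 1) * Module.finrank K (grading X d) := by
  rw [LinearMap.finrank_range_add_finrank_ker, Module.finrank_pi_fintype]
  simp

/-- Multiplication by x_0 is injective and commutes with the differential; by `h` it is bijective
from degree d to degree d + 1. It therefore carries one range isomorphically onto the other. -/
theorem finrank_range_strand (hv : IsCoords v) (hv0 : ∀ p, v p 0 ≠ 0)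
    (hdeg : ∀ i a, F.deg i a = i) (i d : ℕ)
    (h : Module.finrank K (grading X d) = Module.finrank K (grading X (d + 1))) :
    Module.finrank K (LinearMap.range (F.strand hdeg i (d + 1))) =
      Module.finrank K (LinearMap.range (F.strand hdeg i d)) := by
  let l : ∀ b d, (Fin b → grading X d) →ₗ[K] (Fin b → grading X (d + 1)) := fun b d =>
    (mulVar X 0 d).compLeft (Fin b)
  have hcomm : F.strand hdeg i (d + 1) ∘ₗ l _ d = l _ (d + 1) ∘ₗ F.strand hdeg i d := by
    refine LinearMap.ext fun u => funext fun c => Subtype.ext ?_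
    change F.d i (fun a => (u a : CoordRing X) * var X 0) c =
      F.d i (fun a => (u a : CoordRing X)) c * var X 0
    rw [F.d_apply, F.d_apply, Finset.sum_mul]
    exact Finset.sum_congr rfl fun a _ => by ring
  have hsurj : LinearMap.range (l (F.betti (i + 1)) d) = ⊤ := by
    refine LinearMap.range_eq_top.2 fun u => ?_
    have h1 := (LinearMap.injective_iff_surjective_of_finrank_eq_finrank h).1
      (mulVar_injective hv hv0 d)
    choose w hw using fun a => h1 (u a)
    exact ⟨w, funext hw⟩
  have hinj : Function.Injective (l (F.betti i) (d + 1)) := fun u w huw =>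
    funext fun a => mulVar_injective hv hv0 (d + 1) (congrFun huw a)
  rw [← LinearMap.range_comp_of_range_eq_top _ hsurj, hcomm, LinearMap.range_comp]
  exact (Submodule.equivMapOfInjective _ hinj _).finrank_eq.symm

/-- The Betti numbers of a linear resolution for points with Hilbert function
`1, n + 1, s, s, …`. -/
theorem betti_recurrence (hv : IsCoords v) (hv0 : ∀ p, v p 0 ≠ 0)
    (hdeg : ∀ i a, F.deg i a = i) {s : ℕ} (hs : s ≠ 0)
    (h0 : Module.finrank K (grading X 0) = 1)
    (h1 : Module.finrank K (grading X 1) = n + 1) (h2 : Module.finrank K (grading X 2) = s)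
    (h3 : Module.finrank K (grading X 3) = s) :
    (∀ j, (F.betti (j + 4) : ℤ) = n * F.betti (j + 3) - ((s : ℤ) - n - 1) * F.betti (j + 2)) ∧
      (F.betti 2 = 0 → n * F.betti 0 = 0) := by
  -- The kernels on vectors of degree 0, 1, 2, 3 have dimensions 0, b_{i+2}, (n+1) b_{i+2} -
  -- b_{i+3}, and again the latter. Exactness and rank–nullity at degrees 2 and 3 then give the
  -- recurrence.
  have hz0 : ∀ i, Module.finrank K (LinearMap.ker (F.strand hdeg i 0)) = 0 := fun i => by
    rw [F.ker_strand_zero hv hdeg, finrank_bot]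
  have hz1 : ∀ i, Module.finrank K (LinearMap.ker (F.strand hdeg i 1)) = F.betti (i + 2) :=
    fun i => by
      have := F.finrank_strand hdeg (i + 1) 0
      rw [hz0, h0, add_zero, mul_one] at this
      rw [F.ker_strand hv hdeg]
      exact this
  have hz2 : ∀ i, Module.finrank K (LinearMap.ker (F.strand hdeg i 2)) + F.betti (i + 3) =
      F.betti (i + 2) * (n + 1) := fun i => by
    have := F.finrank_strand hdeg (i + 1) 1
    rw [hz1, h1] at this
    rw [F.ker_strand hv hdeg]
    exact this
  have hz3 : ∀ i, Module.finrank K (LinearMap.ker (F.strand hdeg i 3)) =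
      Module.finrank K (LinearMap.ker (F.strand hdeg i 2)) := fun i => by
    have e1 := F.finrank_strand hdeg i 3
    have e2 := F.finrank_strand hdeg i 2
    have e3 := F.finrank_range_strand hv hv0 hdeg i 2 (h2.trans h3.symm)
    rw [h3, e3] at e1
    rw [h2] at e2
    omega
  have hrec : ∀ i, Module.finrank K (LinearMap.ker (F.strand hdeg i 2)) +
      Module.finrank K (LinearMap.ker (F.strand hdeg (i + 1) 2)) = F.betti (i + 2) * s :=
    fun i => by
      have := F.finrank_strand hdeg (i + 1) 2
      rw [← F.ker_strand hv hdeg, hz3, h2] at this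
      exact this
  have hr0 : ∀ d, Module.finrank K (LinearMap.range (F.strand hdeg 0 d)) =
      F.betti 0 * Module.finrank K (grading X (d + 1)) := fun d => by
    rw [F.strand_zero_surjective hv hdeg, finrank_top, Module.finrank_pi_fintype]
    simp
  constructor
  · intro j
    have e1 := hz2 j
    have e2 := hz2 (j + 1)
    have e3 := hrec j
    zify at e1 e2 e3
    linear_combination e1 + e2 - e3
  -- If b_2 = 0, the degree 2 kernel on F_1 vanishes, so s b_1 = s b_0, whereas b_1 = (n + 1) b_0.
  · intro hb
    have e1 := F.finrank_strand hdeg 0 0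
    have e2 := F.finrank_strand hdeg 0 2
    have e3 := hz2 0
    rw [hr0, hz0, h0, h1] at e1
    rw [hr0, h2, h3] at e2
    simp only [zero_add] at e1 e2 e3
    rw [hb, zero_mul] at e3
    have e4 : F.betti 0 = F.betti 1 :=
      Nat.eq_of_mul_eq_mul_right (Nat.pos_of_ne_zero hs) (by omega)
    rw [← e4] at e1
    linarith

end MinimalResolution

/-! ### Hilbert function of generic points -/

theorem AlgebraicIndependent.det_monomial_ne_zero {k K ι σ J : Type*} [Field k] [Field K]
    [Algebra k K] {ξ : ι × σ → K} (h : AlgebraicIndependent k ξ) [Fintype J] [DecidableEq J]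
    {π : J → ι} (hπ : Function.Injective π) {φ : J → σ →₀ ℕ} (hφ : Function.Injective φ) :
    (Matrix.of fun p q => MvPolynomial.eval (fun j => ξ (π p, j))
      (MvPolynomial.monomial (φ q) (1 : K))).det ≠ 0 := by
  classical
  let E : J → J → ι × σ →₀ ℕ := fun p q => (φ q).mapDomain (Prod.mk (π p))
  have hE : ∀ p q p' j, E p q (π p', j) = if p = p' then φ q j else 0 := by
    intro p q p' j
    split_ifs with hp
    · subst hp
      exact Finsupp.mapDomain_apply (Prod.mk_right_injective (π p)) _ _
    · refine Finsupp.mapDomain_of_notMem_range _ _ ?_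
      rintro ⟨j', hj⟩
      exact hp (hπ (Prod.ext_iff.1 hj).1)
  let D : Matrix J J (MvPolynomial (ι × σ) k) :=
    Matrix.of fun p q => MvPolynomial.monomial (E p q) 1
  -- The diagonal monomial arises from the identity permutation alone: the variables of each point
  -- reveal which exponent φ q was used there, and φ is injective.
  have hD : D.det ≠ 0 := by
    intro h0
    have h1 := congrArg (MvPolynomial.coeff (∑ i, E i i)) h0
    rw [Matrix.det_apply, MvPolynomial.coeff_sum, MvPolynomial.coeff_zero,
      Finset.sum_eq_single 1] at h1
    · simp only [D, Matrix.of_apply, Equiv.Perm.sign_one, Equiv.Perm.one_apply, one_smul,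
        ← MvPolynomial.monomial_sum_one, MvPolynomial.coeff_monomial, if_pos] at h1
      exact one_ne_zero h1
    · intro τ _ hτ
      have h2 : ∏ i, D (τ i) i = MvPolynomial.monomial (∑ i, E (τ i) i) 1 := by
        rw [MvPolynomial.monomial_sum_one]
        rfl
      rw [h2, MvPolynomial.coeff_smul, MvPolynomial.coeff_monomial, if_neg, smul_zero]
      intro h3
      refine hτ (Equiv.ext fun q => hφ (Finsupp.ext fun j => ?_))
      have h4 := DFunLike.congr_fun h3 (π (τ q), j)
      simp only [Finsupp.finsetSum_apply, hE, EmbeddingLike.apply_eq_iff_eq] at h4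
      simpa using h4.symm
    · simp
  have hmap : (Matrix.of fun p q => MvPolynomial.eval (fun j => ξ (π p, j))
      (MvPolynomial.monomial (φ q) (1 : K))) = (MvPolynomial.aeval (R := k) ξ).mapMatrix D := by
    ext p q
    simp only [Matrix.of_apply, AlgHom.mapMatrix_apply, Matrix.map_apply, D, E,
      MvPolynomial.eval_monomial, MvPolynomial.aeval_monomial, map_one, one_mul]
    rw [Finsupp.prod_mapDomain_index_inj (Prod.mk_right_injective (π p))]
  rw [hmap, ← AlgHom.map_det]
  exact fun h0 => hD (h (by simpa using h0))

theorem Projectivization.subsingleton_of_fin_one {K : Type*} [Field K] :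
    Subsingleton (Projectivization K (Fin (0 + 1) → K)) := by
  refine ⟨fun p q => ?_⟩
  induction p using Projectivization.ind with
  | h x hx =>
  induction q using Projectivization.ind with
  | h y hy =>
  have hne : ∀ z : Fin (0 + 1) → K, z ≠ 0 → z 0 ≠ 0 := fun z hz h0 =>
    hz (funext fun i => by rw [Fin.fin_one_eq_zero i]; exact h0)
  rw [Projectivization.mk_eq_mk_iff']
  refine ⟨x 0 / y 0, funext fun i => ?_⟩
  rw [Fin.fin_one_eq_zero i, Pi.smul_apply, smul_eq_mul, div_mul_cancel₀ _ (hne y hy)]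

namespace CoordRing

variable {K : Type*} [Field K] {n : ℕ} {X : Set (Projectivization K (Fin (n + 1) → K))}
  {v : X → Fin (n + 1) → K}

theorem finrank_grading_zero (hv : IsCoords v) (hne : X.Nonempty) :
    Module.finrank K (grading X 0) = 1 := by
  have h1 : (1 : CoordRing X) ≠ 0 := by
    obtain ⟨p, hp⟩ := hne
    intro h
    have h2 := congrArg (evalAt hv ⟨p, hp⟩) h
    rw [map_one, map_zero] at h2
    exact one_ne_zero h2
  have h2 : grading X 0 = Submodule.span K {1} := by
    ext r
    rw [mem_grading_zero_iff, Submodule.mem_span_singleton]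
    simp only [Algebra.algebraMap_eq_smul_one]
  rw [h2, finrank_span_singleton h1]

theorem finrank_grading_one {k : Type*} [Field k] [Algebra k K] (hv : IsCoords v)
    (hind : AlgebraicIndependent k fun q : X × Fin (n + 1) => v q.1 q.2) (π : Fin (n + 1) ↪ X) :
    Module.finrank K (grading X 1) = n + 1 := by
  have hli : LinearIndependent K (var X) := by
    rw [Fintype.linearIndependent_iff]
    intro γ hγ
    have hdet := hind.det_monomial_ne_zero π.injective (φ := fun j => Finsupp.single j 1)
      fun i j hij => (Finsupp.single_left_inj one_ne_zero).1 hij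
    refine congrFun (Matrix.eq_zero_of_mulVec_eq_zero hdet (funext fun p => ?_))
    have h1 := congrArg (fun r => (evalAt hv (π p) r).coeff 1) hγ
    simpa [Polynomial.finsetSum_coeff, Matrix.mulVec, dotProduct, mul_comm,
      MvPolynomial.eval_monomial] using h1
  rw [grading_one_eq_span, finrank_span_eq_card hli, Fintype.card_fin]

/-- As many points as monomials already give an invertible square evaluation matrix. -/
theorem eq_zero_of_monomial_embedding {k : Type*} [Field k] [Algebra k K] (hv : IsCoords v)
    (hind : AlgebraicIndependent k fun q : X × Fin (n + 1) => v q.1 q.2) (hfin : X.Finite) {d : ℕ}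
    (π : {e : Fin (n + 1) →₀ ℕ // e.degree = d} ↪ X) {f : MvPolynomial (Fin (n + 1)) K}
    (hf : f.IsHomogeneous d) (hf0 : mk X f = 0) : f = 0 := by
  classical
  have := hfin.fintype
  have := Fintype.ofInjective π π.injective
  have hdet := hind.det_monomial_ne_zero π.injective Subtype.val_injective
  have hsum : f = ∑ e : {e : Fin (n + 1) →₀ ℕ // e.degree = d},
      MvPolynomial.monomial e.1 (f.coeff e.1) := by
    ext e
    rw [MvPolynomial.coeff_sum]
    simp only [MvPolynomial.coeff_monomial]
    by_cases he : e.degree = d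
    · rw [Finset.sum_eq_single ⟨e, he⟩ (fun e' _ h' => if_neg fun h => h' (Subtype.ext h))
        (fun h => absurd (Finset.mem_univ _) h), if_pos rfl]
    · rw [hf.coeff_eq_zero he, Finset.sum_eq_zero]
      rintro ⟨e', he'⟩ -
      exact if_neg fun h : e' = e => he (h ▸ he')
  have hco : (fun e : {e : Fin (n + 1) →₀ ℕ // e.degree = d} => f.coeff e.1) = 0 := by
    refine Matrix.eq_zero_of_mulVec_eq_zero hdet (funext fun p => ?_)
    have h1 := congrArg (evalAt hv (π p)) hf0
    rw [evalAt_mk, evalLine_of_isHomogeneous _ hf, map_zero, Polynomial.monomial_eq_zero_iff,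
      hsum, map_sum] at h1
    rw [Matrix.mulVec, dotProduct, Pi.zero_apply, ← h1]
    refine Finset.sum_congr rfl fun e _ => ?_
    simp [MvPolynomial.eval_monomial, mul_comm]
  rw [hsum]
  exact Finset.sum_eq_zero fun e _ => by rw [congrFun hco e, Pi.zero_apply, map_zero]

/-- One monomial for each point gives an invertible square evaluation matrix. -/
theorem values_surjective {k : Type*} [Field k] [Algebra k K] (hv : IsCoords v)
    (hind : AlgebraicIndependent k fun q : X × Fin (n + 1) => v q.1 q.2) (hfin : X.Finite) {d : ℕ}
    (φ : X ↪ {e : Fin (n + 1) →₀ ℕ // e.degree = d}) : Function.Surjective (values hv d) := by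
  classical
  have := hfin.fintype
  have hdet := hind.det_monomial_ne_zero Function.injective_id (φ := fun p => (φ p).1)
    (Subtype.val_injective.comp φ.injective)
  intro g
  obtain ⟨γ, hγ⟩ := Matrix.exists_mulVec_eq_of_isUnit
    ((Matrix.isUnit_iff_isUnit_det _).2 hdet.isUnit) g
  refine ⟨∑ q, γ q • ⟨mk X (MvPolynomial.monomial (φ q).1 1), mem_grading_iff.2
    ⟨_, MvPolynomial.isHomogeneous_monomial _ (φ q).2, rfl⟩⟩, ?_⟩
  ext p
  rw [← hγ, map_sum, Finset.sum_apply, Matrix.mulVec, dotProduct]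
  refine Finset.sum_congr rfl fun q _ => ?_
  rw [map_smul, Pi.smul_apply, values_apply, evalAt_mk, evalLine_monomial, (φ q).2,
    Polynomial.coeff_monomial, if_pos rfl, smul_eq_mul, mul_comm]
  rfl

theorem not_isKoszul_of_ncard_gt {k : Type*} [Field k] [Algebra k K] (hX : IsGenericPoints k X)
    (hfin : X.Finite) (hne : X.Nonempty) (hcard : 4 + 4 * n + n ^ 2 < 4 * X.ncard) :
    ¬ IsKoszul (grading X) := by
  obtain ⟨v, hv, hind⟩ := hX
  have := hfin.fintype
  have hv0 : ∀ p, v p 0 ≠ 0 := fun p => hind.ne_zero (p, 0)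
  have hX' : Fintype.card X = X.ncard := by
    rw [← Nat.card_eq_fintype_card, Nat.card_coe_set_eq]
  have hn : n ≠ 0 := by
    rintro rfl
    have := Projectivization.subsingleton_of_fin_one (K := K)
    have := X.ncard_le_one_of_subsingleton
    omega
  rcases Function.Embedding.total X {e : Fin (n + 1) →₀ ℕ // e.degree = 2} with ⟨⟨φ⟩⟩ | ⟨⟨π⟩⟩
  · rintro ⟨F, hdeg⟩
    have h2 : Module.finrank K (grading X 2) = X.ncard := by
      rw [(LinearEquiv.ofBijective (values hv 2) ⟨values_injective hv 2,
        values_surjective hv hind hfin φ⟩).finrank_eq, Module.finrank_fintype_fun_eq_card, hX']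
    -- The number of points bounds the dimension above; multiplication by x_0 from degree 2 bounds
    -- it below.
    have h3 : Module.finrank K (grading X 3) = X.ncard := by
      refine le_antisymm ?_ ?_
      · have := LinearMap.finrank_le_finrank_of_injective (values_injective hv 3)
        rwa [Module.finrank_fintype_fun_eq_card, hX'] at this
      · rw [← h2]
        exact LinearMap.finrank_le_finrank_of_injective (mulVar_injective hv hv0 2)
    obtain ⟨π⟩ := Function.Embedding.nonempty_of_card_le
      (show Fintype.card (Fin (n + 1)) ≤ Fintype.card X by rw [hX', Fintype.card_fin]; nlinarith)
    obtain ⟨hrec, hb2⟩ := F.betti_recurrence hv hv0 hdeg ((Set.ncard_pos hfin).2 hne).ne'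
      (finrank_grading_zero hv hne) (finrank_grading_one hv hind π) h2 h3
    have hb0 := betti_zero_pos hv hne F
    have hpos : 0 < F.betti 2 := Nat.pos_of_ne_zero fun h =>
      (Nat.mul_ne_zero hn hb0.ne') (hb2 h)
    -- With e = s - n - 1 the cardinality hypothesis is n² < 4e, that is, a negative discriminant.
    obtain ⟨e, he⟩ : ∃ e, X.ncard = n + 1 + e := Nat.exists_eq_add_of_le (by nlinarith)
    refine not_linear_recurrence (b := fun j => F.betti (j + 2)) (n := n) (e := e) (by omega) hpos
      fun j => ?_
    have := hrec j
    rw [he] at this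
    push_cast at this
    refine this.trans ?_
    ring
  · exact not_isKoszul_of_no_quadric hv hfin hne hn hv0 fun f hf hf0 =>
      eq_zero_of_monomial_embedding hv hind hfin π hf hf0

end CoordRing

theorem mainTheorem3 {k K : Type*} [Field k] [Field K] [Algebra k K] (n : ℕ)
    (X : Set (Projectivization K (Fin (n + 1) → K))) (hfin : X.Finite) (hne : X.Nonempty)
    (hX : IsGenericPoints k X) :
    IsKoszul (CoordRing.grading X) ↔ (X.ncard : ℚ) ≤ 1 + (n : ℚ) + (n : ℚ) ^ 2 / 4 := by
  have hiff : (X.ncard : ℚ) ≤ 1 + (n : ℚ) + (n : ℚ) ^ 2 / 4 ↔ 4 * X.ncard ≤ 4 + 4 * n + n ^ 2 := by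
    rw [← Nat.cast_le (α := ℚ)]
    push_cast
    constructor <;> intro h <;> linarith
  rw [hiff]
  refine ⟨fun h => ?_, CoordRing.isKoszul_of_ncard_le hX hfin hne⟩
  by_contra! h'
  exact CoordRing.not_isKoszul_of_ncard_gt hX hfin hne h' h
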